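/- **Setting.** Let $\Gamma$ be a countable set and let $\Omega=(\mathbb S^2)^\Gamma$ with the product topology. Write $\Lambda\Subset\Gamma$ for finite subsets. For $\Lambda\Subset\Gamma$ regard $\dot{\mathscr A}_\Lambda=C^\infty((\mathbb S^2)^\Lambda,\mathbb C)$ as a subset of the $C^*$-algebra $\mathscr A_\Gamma=C(\Omega,\mathbb C)$, and let $\dot{\mathscr A}_\Gamma=\bigcup_{\Lambda\Subset\Gamma}\dot{\mathscr A}_\Lambda$. On $\dot{\mathscr A}_\Gamma$ consider the Poisson bracket induced by the standard symplectic form on every factor $\mathbb S^2\subset\mathbb R^3$, that is $$\{a,b\}(\sigma)=\sum_{x\in\Lambda\cap\Lambda'}\sigma_x\cdot\big(\nabla_x a(\sigma)\times\nabla_x b(\sigma)\big)\qquad(a\in\dot{\mathscr A}_\Lambda,\ b\in\dot{\mathscr A}_{\Lambda'}),$$ where $\nabla_x$ is the tangential gradient in the spin at $x$. Let $\varphi=\{\varphi_\Lambda\}_{\Lambda\Subset\Gamma}$ be a family of potentials: $\varphi_\varnothing=0$ and $\varphi_\Lambda=\varphi_\Lambda^*\in\dot{\mathscr A}_\Lambda$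 for all $\Lambda\Subset\Gamma$. Put $\bar\varphi_\Lambda=\varphi_\Lambda$ if $|\Lambda|\ge 2$ and $\bar\varphi_\Lambda=0$ otherwise. With $\|\cdot\|$ the supremum norm, let $$\|a\|_{C^1}=\|a\|+\sup_{x\in\Gamma}\sup_{\sigma\in\Omega}\|d_xa(\sigma)\|,\qquad \|\bar\varphi\|_{\varepsilon}=\sup_{x\in\Gamma}\sum_{X\Subset\Gamma,\;X\ni x}e^{\varepsilon(|X|-1)}\|\bar\varphi_X\|,$$ where $d_xa(\sigma)$ is the differential of $a$ in the spin at $x$. For $a\in\dot{\mathscr A}_\Lambda$ let $$\delta_\Gamma(a)=\sum_{X\Subset\Gamma,\;X\cap\Lambda\ne\varnothing}\{a,\varphi_X\}.$$ A $(\beta,\delta_\Gamma)$-KMS classical state is a state $\omega$ on $\mathscr A_\Gamma$ (a positive linear functional with $\omega(1)=1$) such that $\omega(\{a,b\})=\beta\,\omega(b\,\delta_\Gamma(a))$ for all $a,b\in\dot{\mathscr A}_\Gamma$. **Theorem.** Assume that $$\sup_{x\in\Gamma}\sum_{X\Subset\Gamma,\;X\ni x}\|\bar\varphi_X\|_{C^1}<\infty\qquad\text{and}\qquad\|\bar\varphi\|_{\log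 3}<\infty .$$ Then, for every $a\in\dot{\mathscr A}_\Gamma$, the series $\delta_\Gamma(a)$ converges unconditionally in the norm of $\mathscr A_\Gamma$, and for every $$0\le\beta<\frac{\log 2}{6\,\|\bar\varphi\|_{\log 3}}$$ (the right-hand side being $+\infty$ if $\bar\varphi=0$) there exists exactly one $(\beta,\delta_\Gamma)$-KMS classical state on $\mathscr A_\Gamma$. -/

import Mathlib

open scoped Matrix ComplexOrder ENNReal

noncomputable section

namespace SpinLattice

/-- The ambient Euclidean space `ℝ³`. -/
abbrev E3 : Type := EuclideanSpace ℝ (Fin 3)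

/-- The unit sphere `𝕊² ⊂ ℝ³`. -/
abbrev S2 : Type := Metric.sphere (0 : E3) 1

/-- The configuration space `Ω = (𝕊²)^Γ`, with the product topology (it is compact). -/
abbrev Config (Γ : Type*) : Type _ := Γ → S2

/-- The restriction to `Λ ⋐ Γ` of a configuration, seen as a point of the embedded submanifold
`(𝕊²)^Λ` of the vector space `(ℝ³)^Λ`. -/
def restr {Γ : Type*} (Λ : Finset Γ) (σ : Config Γ) : Λ → E3 := fun x => (σ x : E3)

/-- The smooth observables localized in the finite region `Λ`, that is `C^∞((𝕊²)^Λ, ℂ)` seen inside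
`C(Ω, ℂ)`. A function on the closed submanifold `(𝕊²)^Λ ⊂ (ℝ³)^Λ` is smooth if and only if it is the
restriction of a smooth function on `(ℝ³)^Λ`. -/
def smoothLocal {Γ : Type*} (Λ : Finset Γ) : Set C(Config Γ, ℂ) :=
  {a | ∃ F : (Λ → E3) → ℂ, ContDiff ℝ (⊤ : ℕ∞) F ∧ ∀ σ, a σ = F (restr Λ σ)}

/-- The smooth local observables, the union over the finite regions `Λ` of `C^∞((𝕊²)^Λ, ℂ)`: the
domain of the Poisson bracket. -/
def smoothObs (Γ : Type*) : Set C(Config Γ, ℂ) := ⋃ Λ : Finset Γ, smoothLocal Λ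

/-- The radial retraction `v ↦ v / ‖v‖` of `ℝ³ \ {0}` onto `𝕊²` (the value at `0` is arbitrary and
never matters). -/
def radial (v : E3) : S2 :=
  if h : v = 0 then ⟨EuclideanSpace.single 0 1, by simp⟩
  else ⟨‖v‖⁻¹ • v, by simp [norm_smul, h]⟩

open Classical in
/-- The differential at `σ` of `a : Ω → ℂ` with respect to the spin at the site `x`, the other spins
being fixed. It is a linear form on `ℝ³`: the differential of the radially constant extension of
`s ↦ a(σ with s at x)`. It agrees with the differential of that function on the tangent plane of
`𝕊²` at `σ x`, and vanishes on the normal direction `σ x`. -/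
def siteDeriv {Γ : Type*} (a : Config Γ → ℂ) (x : Γ) (σ : Config Γ) : E3 →L[ℝ] ℂ :=
  fderiv ℝ (fun v : E3 => a (Function.update σ x (radial v))) (σ x : E3)

/-- The components of the tangential gradient of `a` in the spin at the site `x`. -/
def siteGrad {Γ : Type*} (a : Config Γ → ℂ) (x : Γ) (σ : Config Γ) : Fin 3 → ℂ :=
  fun i => siteDeriv a x σ (EuclideanSpace.single i 1)

/-- A point of `𝕊²` as a vector of `ℂ³`. -/
def spinVec (s : S2) : Fin 3 → ℂ := fun i => (((s : E3) i : ℝ) : ℂ)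

/-- The Poisson bracket of `a` and `b`, as a function on `Ω`. On each factor `𝕊²` it is the Poisson
bracket of the standard symplectic (area) form, `{a, b}(s) = s · (∇a × ∇b)`; brackets of the
different factors are added up. For local `a` and `b` the sum is finite (only the sites in both
regions contribute, see `poissonFun_eq_sum`). -/
def poissonFun {Γ : Type*} (a b : Config Γ → ℂ) (σ : Config Γ) : ℂ :=
  ∑ᶠ x : Γ, spinVec (σ x) ⬝ᵥ (siteGrad a x σ ⨯₃ siteGrad b x σ)

/-! ### The bracket of smooth local observables is a smooth local observable -/

lemma radial_coe {v : E3} (h : v ≠ 0) : ((radial v : S2) : E3) = ‖v‖⁻¹ • v := by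
  simp [radial, h]

lemma radial_self (s : S2) : radial (s : E3) = s := by
  have h : (s : E3) ≠ 0 := ne_zero_of_mem_unit_sphere s
  apply Subtype.ext
  rw [radial_coe h]
  simp

lemma hasFDerivAt_radial (s : S2) :
    HasFDerivAt (fun v : E3 => ((radial v : S2) : E3))
      (ContinuousLinearMap.id ℝ E3 - (innerSL ℝ (s : E3)).smulRight (s : E3)) (s : E3) := by
  have hs : (s : E3) ≠ 0 := ne_zero_of_mem_unit_sphere s
  have hn : ‖(s : E3)‖ = 1 := by simp
  have h1 : HasFDerivAt (fun v : E3 => ‖v‖ ^ 2) (2 • innerSL ℝ (s : E3)) (s : E3) :=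
    (hasStrictFDerivAt_norm_sq (s : E3)).hasFDerivAt
  have h2 : HasFDerivAt (fun v : E3 => (Real.sqrt (‖v‖ ^ 2))⁻¹) (-innerSL ℝ (s : E3)) (s : E3) := by
    have h3 := (hasDerivAt_inv (𝕜 := ℝ) (x := Real.sqrt (‖(s : E3)‖ ^ 2)) (by simp)).comp_hasFDerivAt
      (s : E3) (h1.sqrt (by simp))
    refine h3.congr_fderiv ?_
    ext w
    simp
  have h4 := h2.smul (hasFDerivAt_id (𝕜 := ℝ) (s : E3))
  have h5 : HasFDerivAt (fun v : E3 => ‖v‖⁻¹ • v)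
      (ContinuousLinearMap.id ℝ E3 - (innerSL ℝ (s : E3)).smulRight (s : E3)) (s : E3) := by
    have hf : (fun v : E3 => ‖v‖⁻¹ • v) = (fun v : E3 => (Real.sqrt (‖v‖ ^ 2))⁻¹) • id := by
      funext v
      simp
    rw [hf]
    refine h4.congr_fderiv ?_
    refine ContinuousLinearMap.ext fun w => ?_
    simp [sub_eq_add_neg]
  refine h5.congr_of_eventuallyEq ?_
  filter_upwards [isOpen_ne.mem_nhds hs] with v hv
  exact radial_coe hv

/-- The extended site gradient of a function on `(ℝ³)^Λ`. -/
def ambGrad {Γ : Type*} {Λ : Finset Γ} (F : (Λ → E3) → ℂ) (x : Λ) (v : Λ → E3) : Fin 3 → ℂ :=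
  open Classical in
  fun i => fderiv ℝ F v (Pi.single x (EuclideanSpace.single i 1))

lemma contDiff_ambGrad {Γ : Type*} {Λ : Finset Γ} {F : (Λ → E3) → ℂ} (hF : ContDiff ℝ (⊤ : ℕ∞) F)
    (x : Λ) (i : Fin 3) : ContDiff ℝ (⊤ : ℕ∞) (fun v => ambGrad F x v i) := by
  unfold ambGrad
  exact (hF.fderiv_right (m := (⊤ : ℕ∞)) (by simp)).clm_apply contDiff_const

/-- The site gradient of a local observable at a site of its region is the projection to the tangent
plane of the gradient of a smooth extension. -/
lemma siteGrad_of_mem {Γ : Type*} {Λ : Finset Γ} {a : Config Γ → ℂ} {F : (Λ → E3) → ℂ}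
    (hF : ContDiff ℝ (⊤ : ℕ∞) F) (ha : ∀ σ, a σ = F (restr Λ σ)) (x : Λ) (σ : Config Γ) :
    siteGrad a x σ = fun i => ambGrad F x (restr Λ σ) i
      - spinVec (σ x) i * (spinVec (σ x) ⬝ᵥ ambGrad F x (restr Λ σ)) := by
  classical
  have hup : ∀ v : E3, restr Λ (Function.update σ (x : Γ) (radial v))
      = Function.update (restr Λ σ) x ((radial v : S2) : E3) := by
    intro v
    funext y
    by_cases h : y = x
    · subst h; simp [restr]
    · have h' : (y : Γ) ≠ x := fun e => h (Subtype.ext e)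
      simp [restr, h, h']
  have hcomp : HasFDerivAt (fun v : E3 => a (Function.update σ (x : Γ) (radial v)))
      ((fderiv ℝ F (restr Λ σ)).comp ((ContinuousLinearMap.single ℝ (fun _ : Λ => E3) x).comp
        (ContinuousLinearMap.id ℝ E3 - (innerSL ℝ (σ x : E3)).smulRight (σ x : E3))))
      (σ x : E3) := by
    have hfun : (fun v : E3 => a (Function.update σ (x : Γ) (radial v)))
        = fun v => F (Function.update (restr Λ σ) x ((radial v : S2) : E3)) := by
      funext v; rw [ha, hup]
    rw [hfun]
    have hp : Function.update (restr Λ σ) x ((radial (σ x : E3) : S2) : E3) = restr Λ σ := by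
      rw [radial_self]; exact Function.update_eq_self _ _
    have hFd : HasFDerivAt F (fderiv ℝ F (restr Λ σ))
        (Function.update (restr Λ σ) x ((radial (σ x : E3) : S2) : E3)) := by
      rw [hp]
      exact (hF.differentiable (by simp) _).hasFDerivAt
    have hu := hasFDerivAt_update (𝕜 := ℝ) (restr Λ σ) (i := x) ((radial (σ x : E3) : S2) : E3)
    have hu' := hu.comp (σ x : E3) (hasFDerivAt_radial (σ x))
    refine (hFd.comp (σ x : E3) hu').congr_fderiv ?_
    refine ContinuousLinearMap.ext fun w => ?_
    simp only [ContinuousLinearMap.comp_apply]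
    congr 1
    funext j
    by_cases h : j = x
    · subst h; simp
    · simp [h]
  funext i
  have hs : (Pi.single x (σ x : E3) : Λ → E3)
      = ∑ j : Fin 3, ((σ x : E3) j) • (Pi.single x (EuclideanSpace.single j (1 : ℝ)) : Λ → E3) := by
    funext y
    by_cases h : y = x
    · subst h
      ext k
      fin_cases k <;> simp [Fin.sum_univ_three]
    · simp [h]
  have hL : (fderiv ℝ F (restr Λ σ)) (Pi.single x (σ x : E3))
      = spinVec (σ x) ⬝ᵥ ambGrad F x (restr Λ σ) := by
    rw [hs]
    simp [dotProduct, spinVec, ambGrad]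
  simp only [siteGrad, siteDeriv, hcomp.fderiv]
  simp only [ContinuousLinearMap.comp_apply, _root_.sub_apply,
    ContinuousLinearMap.id_apply, ContinuousLinearMap.smulRight_apply, map_sub,
    ContinuousLinearMap.map_smul]
  simp only [ContinuousLinearMap.single_apply]
  rw [hL]
  have hin : inner ℝ (σ x : E3) (EuclideanSpace.single i (1 : ℝ)) = (σ x : E3) i := by
    rw [EuclideanSpace.inner_single_right]
    simp
  simp [ambGrad, spinVec, hin]

/-- A local observable does not depend on the spins outside of its region. -/
lemma siteGrad_of_notMem {Γ : Type*} {Λ : Finset Γ} {a : Config Γ → ℂ} {F : (Λ → E3) → ℂ}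
    (ha : ∀ σ, a σ = F (restr Λ σ)) {x : Γ} (hx : x ∉ Λ) (σ : Config Γ) :
    siteGrad a x σ = 0 := by
  classical
  have hfun : (fun v : E3 => a (Function.update σ x (radial v))) = fun _ => a σ := by
    funext v
    rw [ha, ha]
    congr 1
    funext y
    have : (y : Γ) ≠ x := fun e => hx (e ▸ y.2)
    simp [restr, this]
  funext i
  simp [siteGrad, siteDeriv, hfun]

open Classical in
/-- `{a_Λ, b_Λ'}` is the sum of the brackets of the sites in `Λ ∩ Λ'`. -/
lemma poissonFun_eq_sum {Γ : Type*} {Λ Λ' : Finset Γ} {a b : C(Config Γ, ℂ)}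
    (ha : a ∈ smoothLocal Λ) (hb : b ∈ smoothLocal Λ') (σ : Config Γ) :
    poissonFun a b σ
      = ∑ x ∈ Λ ∩ Λ', spinVec (σ x) ⬝ᵥ (siteGrad a x σ ⨯₃ siteGrad b x σ) := by
  obtain ⟨F, -, hF⟩ := ha
  obtain ⟨G, -, hG⟩ := hb
  apply finsum_eq_sum_of_support_subset
  intro x hx
  by_contra h
  apply hx
  have h' : x ∉ Λ ∨ x ∉ Λ' := by
    by_contra h2
    push Not at h2
    exact h (by simpa using h2)
  rcases h' with h' | h'
  · simp [siteGrad_of_notMem hF h']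
  · simp [siteGrad_of_notMem hG h']

lemma smoothLocal_mono {Γ : Type*} {Λ Λ' : Finset Γ} (h : Λ ⊆ Λ') :
    (smoothLocal Λ : Set C(Config Γ, ℂ)) ⊆ smoothLocal Λ' := by
  rintro a ⟨F, hF, ha⟩
  refine ⟨fun v => F (fun x => v ⟨x, h x.2⟩), hF.comp ?_, fun σ => ha σ⟩
  exact contDiff_pi.2 fun x => contDiff_apply ℝ E3 _

lemma triple_proj (s g h : Fin 3 → ℂ) (c d : ℂ) :
    s ⬝ᵥ ((fun i => g i - s i * c) ⨯₃ (fun i => h i - s i * d)) = s ⬝ᵥ (g ⨯₃ h) := by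
  simp [cross_apply, dotProduct, Fin.sum_univ_three]
  ring

lemma continuous_restr {Γ : Type*} (Λ : Finset Γ) : Continuous (restr Λ) := by
  unfold restr
  fun_prop

lemma exists_poissonFun {Γ : Type*} {Λ : Finset Γ} {a b : C(Config Γ, ℂ)}
    (ha : a ∈ smoothLocal Λ) (hb : b ∈ smoothLocal Λ) :
    ∃ B : (Λ → E3) → ℂ, ContDiff ℝ (⊤ : ℕ∞) B ∧ ∀ σ, poissonFun a b σ = B (restr Λ σ) := by
  classical
  have hsum := poissonFun_eq_sum ha hb
  obtain ⟨F, hF, haF⟩ := ha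
  obtain ⟨G, hG, hbG⟩ := hb
  refine ⟨fun v => ∑ x : Λ, (fun i => ((v x i : ℝ) : ℂ)) ⬝ᵥ (ambGrad F x v ⨯₃ ambGrad G x v),
    ?_, ?_⟩
  · apply ContDiff.sum
    intro x _
    have hv : ∀ i : Fin 3, ContDiff ℝ (⊤ : ℕ∞) (fun v : Λ → E3 => ((v x i : ℝ) : ℂ)) := by
      intro i
      refine Complex.ofRealCLM.contDiff.comp ?_
      exact (EuclideanSpace.proj (𝕜 := ℝ) i).contDiff.comp (contDiff_apply ℝ E3 x)
    have h1 := contDiff_ambGrad hF x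
    have h2 := contDiff_ambGrad hG x
    simp only [cross_apply, dotProduct, Fin.sum_univ_three, Matrix.cons_val]
    exact (((hv 0).mul (((h1 1).mul (h2 2)).sub ((h1 2).mul (h2 1)))).add
      ((hv 1).mul (((h1 2).mul (h2 0)).sub ((h1 0).mul (h2 2))))).add
      ((hv 2).mul (((h1 0).mul (h2 1)).sub ((h1 1).mul (h2 0))))
  · intro σ
    rw [hsum, Finset.inter_self, ← Finset.sum_coe_sort]
    refine Finset.sum_congr rfl fun x _ => ?_
    rw [siteGrad_of_mem hF haF, siteGrad_of_mem hG hbG, triple_proj]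
    rfl

lemma exists_common {Γ : Type*} (a b : smoothObs Γ) :
    ∃ Λ : Finset Γ, (a : C(Config Γ, ℂ)) ∈ smoothLocal Λ ∧ (b : C(Config Γ, ℂ)) ∈ smoothLocal Λ := by
  classical
  obtain ⟨Λ, hΛ⟩ := Set.mem_iUnion.1 a.2
  obtain ⟨Λ', hΛ'⟩ := Set.mem_iUnion.1 b.2
  exact ⟨Λ ∪ Λ', smoothLocal_mono Finset.subset_union_left hΛ,
    smoothLocal_mono Finset.subset_union_right hΛ'⟩

lemma continuous_poissonFun {Γ : Type*} (a b : smoothObs Γ) :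
    Continuous (poissonFun (a : C(Config Γ, ℂ)) (b : C(Config Γ, ℂ))) := by
  obtain ⟨Λ, ha, hb⟩ := exists_common a b
  obtain ⟨B, hB, h⟩ := exists_poissonFun ha hb
  have : poissonFun (a : C(Config Γ, ℂ)) (b : C(Config Γ, ℂ)) = fun σ => B (restr Λ σ) :=
    funext h
  rw [this]
  exact hB.continuous.comp (continuous_restr Λ)

/-- The Poisson bracket of two smooth local observables; it is again a smooth local observable. -/
def poisson {Γ : Type*} (a b : smoothObs Γ) : smoothObs Γ :=
  ⟨⟨poissonFun (a : C(Config Γ, ℂ)) (b : C(Config Γ, ℂ)), continuous_poissonFun a b⟩, by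
    obtain ⟨Λ, ha, hb⟩ := exists_common a b
    obtain ⟨B, hB, h⟩ := exists_poissonFun ha hb
    exact Set.mem_iUnion.2 ⟨Λ, B, hB, h⟩⟩

/-! ### Potentials, their norms, and the derivation they generate -/

/-- A family of self-adjoint (that is, real-valued) potentials `φ_Λ ∈ C^∞((𝕊²)^Λ)`, one for each
finite region `Λ`, with `φ_∅ = 0`. -/
structure Potential (Γ : Type*) where
  toFun : Finset Γ → C(Config Γ, ℂ)
  smooth : ∀ Λ, toFun Λ ∈ smoothLocal Λ
  selfAdjoint : ∀ Λ, IsSelfAdjoint (toFun Λ)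
  empty : toFun ∅ = 0

/-- The potential `φ_X` as a smooth local observable. -/
def Potential.obs {Γ : Type*} (φ : Potential Γ) (X : Finset Γ) : smoothObs Γ :=
  ⟨φ.toFun X, Set.mem_iUnion.2 ⟨X, φ.smooth X⟩⟩

/-- The multi-site part `φ̄` of the potential: the single-site potentials are replaced by `0`. -/
def Potential.multi {Γ : Type*} (φ : Potential Γ) (X : Finset Γ) : C(Config Γ, ℂ) :=
  if 2 ≤ X.card then φ.toFun X else 0

/-- The `C¹` norm of a local observable: the sup norm of the function plus the supremum, over the
sites and the configurations, of the norm of the differential in the spin at that site. -/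
def c1Norm {Γ : Type*} (a : C(Config Γ, ℂ)) : ℝ≥0∞ :=
  ‖a‖ₑ + ⨆ x : Γ, ⨆ σ : Config Γ, ‖siteDeriv a x σ‖ₑ

/-- `sup_x ∑_{X ∋ x} ‖φ̄_X‖_{C¹}`, in `[0, ∞]`. -/
def Potential.multiC1 {Γ : Type*} (φ : Potential Γ) : ℝ≥0∞ :=
  ⨆ x : Γ, ∑' X : {X : Finset Γ // x ∈ X}, c1Norm (φ.multi X)

/-- `‖φ̄‖_ε = sup_x ∑_{X ∋ x} e^{ε (|X| - 1)} ‖φ̄_X‖`, in `[0, ∞]`. -/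
def Potential.multiNorm {Γ : Type*} (φ : Potential Γ) (ε : ℝ) : ℝ≥0∞ :=
  ⨆ x : Γ, ∑' X : {X : Finset Γ // x ∈ X},
    ENNReal.ofReal (Real.exp (ε * ((X.1.card : ℝ) - 1))) * ‖φ.multi X‖ₑ

/-- The terms `{a, φ_X}` of the series that defines `δ_Γ(a)`. If `a` is localized in `Λ`, the term of
`X` vanishes unless `X` meets `Λ` (see `Potential.term_eq_zero`). -/
def Potential.term {Γ : Type*} (φ : Potential Γ) (a : smoothObs Γ) (X : Finset Γ) :
    C(Config Γ, ℂ) :=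
  (poisson a (φ.obs X) : C(Config Γ, ℂ))

lemma Potential.term_eq_zero {Γ : Type*} (φ : Potential Γ) {Λ X : Finset Γ} (a : smoothObs Γ)
    (ha : (a : C(Config Γ, ℂ)) ∈ smoothLocal Λ) (h : Disjoint Λ X) : φ.term a X = 0 := by
  classical
  ext σ
  have := poissonFun_eq_sum ha (φ.smooth X) σ
  rw [Finset.disjoint_iff_inter_eq_empty.1 h, Finset.sum_empty] at this
  exact this

/-- The derivation `δ_Γ(a) = ∑_X {a, φ_X}`, with convergence in the sup norm of `C(Ω, ℂ)`. -/
def Potential.deriv {Γ : Type*} (φ : Potential Γ) (a : smoothObs Γ) : C(Config Γ, ℂ) :=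
  ∑' X : Finset Γ, φ.term a X

/-! ### States and the classical KMS condition -/

/-- `ω` is a state on `C(Ω, ℂ)`: a positive linear functional with `ω(1) = 1`. -/
def IsState {Γ : Type*} (ω : C(Config Γ, ℂ) →ₚ[ℂ] ℂ) : Prop := ω 1 = 1

/-- `ω` is a `(β, δ)`-KMS classical state: a state with `ω({a, b}) = β ω(b δ(a))` for all smooth
local observables `a` and `b`. -/
def IsKMS {Γ : Type*} (β : ℝ) (δ : smoothObs Γ → C(Config Γ, ℂ))
    (ω : C(Config Γ, ℂ) →ₚ[ℂ] ℂ) : Prop :=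
  IsState ω ∧ ∀ a b : smoothObs Γ,
    ω (poisson a b : C(Config Γ, ℂ)) = (β : ℂ) * ω ((b : C(Config Γ, ℂ)) * δ a)

end SpinLattice

end

noncomputable section

namespace SpinLattice

open scoped Classical
open MeasureTheory Filter Topology

variable {Γ : Type*}

/-! ### Calculus of smooth local observables -/

/-! Convergence of the derivation is a matter of counting. The bracket `{a, φ_X}` is a sum over the
sites common to `X` and the region of `a`, each summand is controlled by the C¹ norm of `φ_X`, and
only the finitely many singletons inside that region escape the bound by `φ̄` (`summable_term`).

Existence holds for every real β. The function `{u·σ_x, ·}` is, up to sign, the derivative along the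
rotations of the spin at `x` about `u`, which preserve the product of the uniform measures. A
general bracket is a combination of such derivatives up to the curl of a gradient, so brackets of
local observables have integral zero (`integral_poissonFun`). Applied to `a` and `b e^{-βH_Λ}`, this
is the KMS identity for the finite-volume Gibbs state, with the derivation truncated to `X ⊆ Λ`
(`Potential.gibbs_poisson`). The truncations converge in norm, so an ultrafilter limit of Gibbs
states is KMS (`exists_isKMS`). Countability of `Γ` serves only here, for integrating continuous
functions over `Ω`.

Uniqueness goes through the Dobrushin–Lanford–Ruelle equations. Let `H_x` be the sum of the
potentials whose region contains `x`. If `ω` is KMS, then `f ↦ ω(e^{βH_x} f)` kills every `{u·σ_x,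
b}` (`reweighted_poisson`), hence is invariant under rotations of the spin at `x`, hence does not
change when `f` is averaged over that spin (`clm_siteAvg_eq`). Undoing the weight, `ω` is invariant
under the conditional Gibbs expectation at `x` (`kms_siteGibbs`). This expectation removes the
oscillation of `f` at `x` and adds to the oscillation at each `y ≠ x` at most the fraction `8β ∑_{X
∋ x,y} ‖φ̄_X‖` of it (`osc_siteGibbs_le`). For β in the given range these fractions sum to at most
1/2 (`Potential.tsum_influence_le`), so a uniform bound of `ω₁ - ω₂` by oscillations can be halved
again and again (`IsEstimate.half`). Two KMS states therefore agree on local observables, which are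
dense. Single-site potentials need no bound: they are finite exceptions in the sums and cancel when
the spin at `y` changes in `H_x`. -/

lemma smoothLocal_const (Λ : Finset Γ) (c : ℂ) :
    ContinuousMap.const (Config Γ) c ∈ smoothLocal Λ :=
  ⟨fun _ => c, contDiff_const, fun _ => rfl⟩

lemma smoothLocal_add {Λ : Finset Γ} {a b : C(Config Γ, ℂ)} (ha : a ∈ smoothLocal Λ)
    (hb : b ∈ smoothLocal Λ) : a + b ∈ smoothLocal Λ := by
  obtain ⟨F, hF, hFa⟩ := ha
  obtain ⟨G, hG, hGb⟩ := hb
  exact ⟨fun v => F v + G v, hF.add hG, fun σ => by simp [hFa, hGb]⟩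

lemma smoothLocal_mul {Λ : Finset Γ} {a b : C(Config Γ, ℂ)} (ha : a ∈ smoothLocal Λ)
    (hb : b ∈ smoothLocal Λ) : a * b ∈ smoothLocal Λ := by
  obtain ⟨F, hF, hFa⟩ := ha
  obtain ⟨G, hG, hGb⟩ := hb
  exact ⟨fun v => F v * G v, hF.mul hG, fun σ => by simp [hFa, hGb]⟩

lemma smoothLocal_smul {Λ : Finset Γ} {a : C(Config Γ, ℂ)} (c : ℂ) (ha : a ∈ smoothLocal Λ) :
    c • a ∈ smoothLocal Λ := by
  obtain ⟨F, hF, hFa⟩ := ha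
  exact ⟨fun v => c * F v, contDiff_const.mul hF, fun σ => by simp [hFa]⟩

lemma smoothLocal_star {Λ : Finset Γ} {a : C(Config Γ, ℂ)} (ha : a ∈ smoothLocal Λ) :
    star a ∈ smoothLocal Λ := by
  obtain ⟨F, hF, hFa⟩ := ha
  exact ⟨fun v => Complex.conjCLE (F v), Complex.conjCLE.contDiff.comp hF,
    fun σ => by simp [hFa]⟩

lemma smoothLocal_zero (Λ : Finset Γ) : (0 : C(Config Γ, ℂ)) ∈ smoothLocal Λ :=
  smoothLocal_const Λ 0

lemma smoothLocal_sum {ι : Type*} {Λ : Finset Γ} (S : Finset ι) {a : ι → C(Config Γ, ℂ)}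
    (ha : ∀ i ∈ S, a i ∈ smoothLocal Λ) : ∑ i ∈ S, a i ∈ smoothLocal Λ := by
  induction S using Finset.induction_on with
  | empty => simpa using smoothLocal_zero Λ
  | insert i S hi ih =>
    rw [Finset.sum_insert hi]
    exact smoothLocal_add (ha i (by simp)) (ih fun j hj => ha j (by simp [hj]))

/-- The pointwise exponential of an observable. -/
def expObs (a : C(Config Γ, ℂ)) : C(Config Γ, ℂ) :=
  (⟨Complex.exp, Complex.continuous_exp⟩ : C(ℂ, ℂ)).comp a

@[simp]
lemma expObs_apply (a : C(Config Γ, ℂ)) (σ : Config Γ) : expObs a σ = Complex.exp (a σ) := rfl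

lemma continuous_expObs : Continuous (expObs : C(Config Γ, ℂ) → C(Config Γ, ℂ)) :=
  ContinuousMap.continuous_postcomp _

lemma smoothLocal_exp {Λ : Finset Γ} {a : C(Config Γ, ℂ)} (ha : a ∈ smoothLocal Λ) :
    expObs a ∈ smoothLocal Λ := by
  obtain ⟨F, hF, hFa⟩ := ha
  exact ⟨fun v => Complex.exp (F v), hF.cexp, fun σ => by simp [hFa]⟩

lemma mem_smoothObs {Λ : Finset Γ} {a : C(Config Γ, ℂ)} (ha : a ∈ smoothLocal Λ) :
    a ∈ smoothObs Γ :=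
  Set.mem_iUnion.2 ⟨Λ, ha⟩

/-- `siteDeriv` is an `fderiv`, which is zero by default where differentiability fails.
Differentiability for local observables is what licenses the sum, product and chain rules for
`siteGrad`. -/
lemma hasFDerivAt_site {Λ : Finset Γ} {a : C(Config Γ, ℂ)} (ha : a ∈ smoothLocal Λ) (x : Γ)
    (σ : Config Γ) :
    HasFDerivAt (fun v : E3 => a (Function.update σ x (radial v))) (siteDeriv a x σ)
      (σ x : E3) := by
  obtain ⟨F, hF, hFa⟩ := ha
  refine DifferentiableAt.hasFDerivAt ?_
  simp only [hFa]
  refine (hF.differentiable (by simp) _).comp (σ x : E3) ?_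
  refine differentiableAt_pi.2 fun y => ?_
  by_cases h : (y : Γ) = x
  · have : (fun v : E3 => restr Λ (Function.update σ x (radial v)) y)
        = fun v => ((radial v : S2) : E3) := by
      funext v; simp [restr, h]
    rw [this]
    exact (hasFDerivAt_radial (σ x)).differentiableAt
  · have : (fun v : E3 => restr Λ (Function.update σ x (radial v)) y) = fun v => (σ y : E3) := by
      funext v; simp [restr, h]
    rw [this]
    exact differentiableAt_const _

lemma update_radial_self (σ : Config Γ) (x : Γ) :
    Function.update σ x (radial (σ x : E3)) = σ := by
  rw [radial_self, Function.update_eq_self]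

section siteGrad
variable {Λ : Finset Γ} {a b : C(Config Γ, ℂ)}

lemma siteGrad_add (ha : a ∈ smoothLocal Λ) (hb : b ∈ smoothLocal Λ) (x : Γ) (σ : Config Γ) :
    siteGrad (a + b : C(Config Γ, ℂ)) x σ = siteGrad a x σ + siteGrad b x σ := by
  have h : siteDeriv (a + b : C(Config Γ, ℂ)) x σ = siteDeriv a x σ + siteDeriv b x σ :=
    ((hasFDerivAt_site ha x σ).add (hasFDerivAt_site hb x σ)).fderiv
  funext i
  simp only [siteGrad, h]
  simp [siteGrad]

lemma siteGrad_mul (ha : a ∈ smoothLocal Λ) (hb : b ∈ smoothLocal Λ) (x : Γ) (σ : Config Γ) :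
    siteGrad (a * b : C(Config Γ, ℂ)) x σ = a σ • siteGrad b x σ + b σ • siteGrad a x σ := by
  have h : siteDeriv (a * b : C(Config Γ, ℂ)) x σ = a σ • siteDeriv b x σ + b σ • siteDeriv a x σ := by
    have := ((hasFDerivAt_site ha x σ).mul (hasFDerivAt_site hb x σ)).fderiv
    rw [update_radial_self] at this
    exact this
  funext i
  simp only [siteGrad, h]
  simp [siteGrad]

lemma siteGrad_exp (ha : a ∈ smoothLocal Λ) (x : Γ) (σ : Config Γ) :
    siteGrad (expObs a) x σ = expObs a σ • siteGrad a x σ := by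
  have h : siteDeriv (expObs a) x σ = expObs a σ • siteDeriv a x σ := by
    have := ((hasFDerivAt_site ha x σ).cexp).fderiv
    rw [update_radial_self] at this
    exact this
  funext i
  simp [siteGrad, h]

lemma siteGrad_const (c : ℂ) (x : Γ) (σ : Config Γ) :
    siteGrad (ContinuousMap.const (Config Γ) c) x σ = 0 := by
  funext i
  simp [siteGrad, siteDeriv]

lemma siteGrad_smul (c : ℂ) (ha : a ∈ smoothLocal Λ) (x : Γ) (σ : Config Γ) :
    siteGrad (c • a : C(Config Γ, ℂ)) x σ = c • siteGrad a x σ := by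
  have : c • a = ContinuousMap.const (Config Γ) c * a := by ext; simp
  rw [this, siteGrad_mul (smoothLocal_const Λ c) ha, siteGrad_const]
  simp

end siteGrad

section poissonFun
variable {Λ : Finset Γ} {a b c : C(Config Γ, ℂ)}

lemma poissonFun_add_right (ha : a ∈ smoothLocal Λ) (hb : b ∈ smoothLocal Λ)
    (hc : c ∈ smoothLocal Λ) (σ : Config Γ) :
    poissonFun a (b + c : C(Config Γ, ℂ)) σ = poissonFun a b σ + poissonFun a c σ := by
  rw [poissonFun_eq_sum ha hb, poissonFun_eq_sum ha hc,
    poissonFun_eq_sum ha (smoothLocal_add hb hc), ← Finset.sum_add_distrib]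
  refine Finset.sum_congr rfl fun x _ => ?_
  rw [siteGrad_add hb hc, map_add, dotProduct_add]

lemma poissonFun_mul_right (ha : a ∈ smoothLocal Λ) (hb : b ∈ smoothLocal Λ)
    (hc : c ∈ smoothLocal Λ) (σ : Config Γ) :
    poissonFun a (b * c : C(Config Γ, ℂ)) σ
      = b σ * poissonFun a c σ + c σ * poissonFun a b σ := by
  rw [poissonFun_eq_sum ha hb, poissonFun_eq_sum ha hc,
    poissonFun_eq_sum ha (smoothLocal_mul hb hc), Finset.mul_sum, Finset.mul_sum,
    ← Finset.sum_add_distrib]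
  refine Finset.sum_congr rfl fun x _ => ?_
  rw [siteGrad_mul hb hc, map_add, dotProduct_add, map_smul, map_smul, dotProduct_smul,
    dotProduct_smul, smul_eq_mul, smul_eq_mul]

lemma poissonFun_exp_right (ha : a ∈ smoothLocal Λ) (hb : b ∈ smoothLocal Λ) (σ : Config Γ) :
    poissonFun a (expObs b) σ = expObs b σ * poissonFun a b σ := by
  rw [poissonFun_eq_sum ha hb, poissonFun_eq_sum ha (smoothLocal_exp hb), Finset.mul_sum]
  refine Finset.sum_congr rfl fun x _ => ?_
  rw [siteGrad_exp hb, map_smul, dotProduct_smul, smul_eq_mul]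

lemma poissonFun_smul_right (z : ℂ) (ha : a ∈ smoothLocal Λ) (hb : b ∈ smoothLocal Λ)
    (σ : Config Γ) :
    poissonFun a (z • b : C(Config Γ, ℂ)) σ = z * poissonFun a b σ := by
  rw [poissonFun_eq_sum ha hb, poissonFun_eq_sum ha (smoothLocal_smul z hb), Finset.mul_sum]
  refine Finset.sum_congr rfl fun x _ => ?_
  rw [siteGrad_smul z hb, map_smul, dotProduct_smul, smul_eq_mul]

lemma poissonFun_zero_right (a : C(Config Γ, ℂ)) (σ : Config Γ) :
    poissonFun a (0 : C(Config Γ, ℂ)) σ = 0 := by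
  have h : ∀ x, siteGrad (0 : C(Config Γ, ℂ)) x σ = 0 := fun x => siteGrad_const 0 x σ
  simp only [poissonFun, h, map_zero, dotProduct_zero, finsum_zero]

lemma poissonFun_sum_right {ι : Type*} (S : Finset ι) {f : ι → C(Config Γ, ℂ)}
    (ha : a ∈ smoothLocal Λ) (hf : ∀ i ∈ S, f i ∈ smoothLocal Λ) (σ : Config Γ) :
    poissonFun a (∑ i ∈ S, f i : C(Config Γ, ℂ)) σ = ∑ i ∈ S, poissonFun a (f i) σ := by
  induction S using Finset.induction_on with
  | empty => simpa using poissonFun_zero_right a σ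
  | insert i S hi ih =>
    have h2 : ∀ j ∈ S, f j ∈ smoothLocal Λ := fun j hj => hf j (by simp [hj])
    rw [Finset.sum_insert hi, Finset.sum_insert hi,
      poissonFun_add_right ha (hf i (by simp)) (smoothLocal_sum S h2), ih h2]

end poissonFun

/-! ### The linear observables of one spin -/

/-- The component of the spin at `x` in the direction `u`. -/
def spinObs (x : Γ) (u : E3) : C(Config Γ, ℂ) :=
  ⟨fun σ => ((inner ℝ u (σ x : E3) : ℝ) : ℂ), by fun_prop⟩

/-- The cartesian components of a vector, as complex numbers. -/
def complexVec (u : E3) : Fin 3 → ℂ := fun i => ((u i : ℝ) : ℂ)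

lemma inner_ambient_contDiff (x : Γ) (u : E3) : ContDiff ℝ (⊤ : ℕ∞)
    (fun v : ({x} : Finset Γ) → E3 => ((inner ℝ u (v ⟨x, by simp⟩) : ℝ) : ℂ)) :=
  (Complex.ofRealCLM.comp ((innerSL ℝ u).comp
    (ContinuousLinearMap.proj (R := ℝ) (φ := fun _ : ({x} : Finset Γ) => E3)
      ⟨x, by simp⟩))).contDiff

lemma spinObs_mem (x : Γ) (u : E3) : spinObs x u ∈ smoothLocal ({x} : Finset Γ) :=
  ⟨_, inner_ambient_contDiff x u, fun _ => rfl⟩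

lemma siteGrad_spinObs (x : Γ) (u : E3) (σ : Config Γ) :
    siteGrad (spinObs x u) x σ
      = fun i => complexVec u i - spinVec (σ x) i * (spinVec (σ x) ⬝ᵥ complexVec u) := by
  have h := siteGrad_of_mem (inner_ambient_contDiff x u) (a := spinObs x u) (fun _ => rfl)
    ⟨x, by simp⟩ σ
  have hg : ∀ v, ambGrad (fun v : ({x} : Finset Γ) → E3 =>
      ((inner ℝ u (v ⟨x, by simp⟩) : ℝ) : ℂ)) ⟨x, by simp⟩ v = complexVec u := by
    intro v
    funext i
    have hd : fderiv ℝ (fun v : ({x} : Finset Γ) → E3 =>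
        ((inner ℝ u (v ⟨x, by simp⟩) : ℝ) : ℂ)) v = (Complex.ofRealCLM.comp ((innerSL ℝ u).comp
          (ContinuousLinearMap.proj (R := ℝ) (φ := fun _ : ({x} : Finset Γ) => E3)
            ⟨x, by simp⟩))) :=
      (Complex.ofRealCLM.comp ((innerSL ℝ u).comp (ContinuousLinearMap.proj (R := ℝ)
        (φ := fun _ : ({x} : Finset Γ) => E3) ⟨x, by simp⟩))).hasFDerivAt.fderiv
    simp [ambGrad, hd, complexVec, EuclideanSpace.inner_single_right]
  rw [hg] at h
  exact h

/-- A triple product with a repeated vector vanishes, so the bracket does not see the normal part of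
a gradient. Tangential gradients may thus be replaced by gradients of ambient extensions. -/
lemma triple_proj_left (s g h : Fin 3 → ℂ) (c : ℂ) :
    s ⬝ᵥ ((fun i => g i - s i * c) ⨯₃ h) = s ⬝ᵥ (g ⨯₃ h) := by
  simpa using triple_proj s g h c 0

lemma triple_proj_right (s g h : Fin 3 → ℂ) (c : ℂ) :
    s ⬝ᵥ (g ⨯₃ (fun i => h i - s i * c)) = s ⬝ᵥ (g ⨯₃ h) := by
  simpa using triple_proj s g h 0 c

lemma poissonFun_spinObs {Λ : Finset Γ} {b : C(Config Γ, ℂ)} (hb : b ∈ smoothLocal Λ) (x : Γ)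
    (u : E3) (σ : Config Γ) :
    poissonFun (spinObs x u) b σ = spinVec (σ x) ⬝ᵥ (complexVec u ⨯₃ siteGrad b x σ) := by
  rw [poissonFun_eq_sum (spinObs_mem x u) (smoothLocal_mono (Finset.subset_insert x Λ) hb)]
  have : ({x} : Finset Γ) ∩ insert x Λ = {x} :=
    Finset.inter_eq_left.2 (by simp)
  rw [this, Finset.sum_singleton, siteGrad_spinObs, triple_proj_left]

/-- A partial derivative of an extension of a local observable. -/
def ambObs {Λ : Finset Γ} {F : (Λ → E3) → ℂ} (hF : ContDiff ℝ (⊤ : ℕ∞) F) (x : Λ) (i : Fin 3) :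
    C(Config Γ, ℂ) :=
  ⟨fun σ => ambGrad F x (restr Λ σ) i, (contDiff_ambGrad hF x i).continuous.comp
    (continuous_restr Λ)⟩

lemma ambObs_mem {Λ : Finset Γ} {F : (Λ → E3) → ℂ} (hF : ContDiff ℝ (⊤ : ℕ∞) F) (x : Λ)
    (i : Fin 3) : ambObs hF x i ∈ smoothLocal Λ :=
  ⟨_, contDiff_ambGrad hF x i, fun _ => rfl⟩

/-- Chain rule: the bracket is a derivation in its first argument, and an ambient extension
expresses `a` through the coordinates of the spins. This reduces general brackets to generators of
rotations. -/
lemma poissonFun_eq_sum_spinObs {Λ : Finset Γ} {a b : C(Config Γ, ℂ)} {F : (Λ → E3) → ℂ}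
    (hF : ContDiff ℝ (⊤ : ℕ∞) F) (ha : ∀ σ, a σ = F (restr Λ σ)) (hb : b ∈ smoothLocal Λ)
    (σ : Config Γ) :
    poissonFun a b σ = ∑ x : Λ, ∑ i : Fin 3,
      ambObs hF x i σ * poissonFun (spinObs (x : Γ) (EuclideanSpace.single i 1)) b σ := by
  rw [poissonFun_eq_sum ⟨F, hF, ha⟩ hb, Finset.inter_self, ← Finset.sum_coe_sort]
  refine Finset.sum_congr rfl fun x _ => ?_
  rw [siteGrad_of_mem hF ha, triple_proj_left]
  simp only [poissonFun_spinObs hb]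
  simp [Fin.sum_univ_three, complexVec, cross_apply, dotProduct, ambObs]
  ring

lemma ambGrad_symm {Λ : Finset Γ} {F : (Λ → E3) → ℂ} (hF : ContDiff ℝ (⊤ : ℕ∞) F) (x : Λ)
    (i j : Fin 3) (v : Λ → E3) :
    ambGrad (fun v => ambGrad F x v i) x v j = ambGrad (fun v => ambGrad F x v j) x v i := by
  have hs : IsSymmSndFDerivAt ℝ F v :=
    (hF.contDiffAt (x := v)).isSymmSndFDerivAt
      (by rw [minSmoothness_of_isRCLikeNormedField]; exact WithTop.coe_le_coe.2 le_top)
  have hd : Differentiable ℝ (fderiv ℝ F) :=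
    (hF.fderiv_right (m := (⊤ : ℕ∞)) (by simp)).differentiable (by simp)
  have key : ∀ w w' : Λ → E3, fderiv ℝ (fun v => fderiv ℝ F v w) v w'
      = fderiv ℝ (fderiv ℝ F) v w' w := by
    intro w w'
    have := ((hd v).hasFDerivAt.clm_apply (hasFDerivAt_const w v)).fderiv
    rw [this]
    simp
  simp only [ambGrad]
  rw [key, key]
  exact hs _ _

/-- The sum is the spin dotted with the curl of the gradient of `F` at the site `x`; it vanishes
because second derivatives commute (`ambGrad_symm`). It is the correction term in the integration by
parts of `integral_poissonFun`. -/
lemma sum_poissonFun_spinObs_ambObs {Λ : Finset Γ} {F : (Λ → E3) → ℂ}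
    (hF : ContDiff ℝ (⊤ : ℕ∞) F) (x : Λ) (σ : Config Γ) :
    ∑ i : Fin 3, poissonFun (spinObs (x : Γ) (EuclideanSpace.single i 1)) (ambObs hF x i) σ
      = 0 := by
  have h1 : ∀ i, siteGrad (ambObs hF x i) x σ = _ := fun i =>
    siteGrad_of_mem (contDiff_ambGrad hF x i) (a := ambObs hF x i) (fun _ => rfl) x σ
  simp only [poissonFun_spinObs (ambObs_mem hF x _), h1, triple_proj_right]
  simp only [Fin.sum_univ_three, complexVec, cross_apply, dotProduct]
  simp only [ambGrad_symm hF x 1 0, ambGrad_symm hF x 2 0, ambGrad_symm hF x 2 1]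
  simp
  ring

/-! ### Unconditional convergence of the derivation -/

lemma enorm_le_of_forall_apply {X : Type*} [TopologicalSpace X] [CompactSpace X] {f : C(X, ℂ)}
    {C : ℝ≥0∞} (h : ∀ x, ‖f x‖ₑ ≤ C) : ‖f‖ₑ ≤ C := by
  by_cases hC : C = ⊤
  · simp [hC]
  lift C to NNReal using hC
  rw [enorm_le_coe, ← NNReal.coe_le_coe, coe_nnnorm]
  refine (ContinuousMap.norm_le _ C.2).2 fun x => ?_
  have := h x
  rw [enorm_le_coe, ← NNReal.coe_le_coe, coe_nnnorm] at this
  exact this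

lemma norm_spinVec_le (s : S2) (i : Fin 3) : ‖spinVec s i‖ ≤ 1 := by
  have h := EuclideanSpace.norm_sq_eq (s : E3)
  have hn : ‖(s : E3)‖ = 1 := by simp
  have h2 : ‖(s : E3) i‖ ^ 2 ≤ ∑ j, ‖(s : E3) j‖ ^ 2 :=
    Finset.single_le_sum (f := fun j => ‖(s : E3) j‖ ^ 2) (fun j _ => by positivity)
      (Finset.mem_univ i)
  have h3 : ‖spinVec s i‖ = ‖(s : E3) i‖ := by simp [spinVec]
  rw [h3]
  rw [← h, hn] at h2
  nlinarith [norm_nonneg ((s : E3) i)]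

/-- The determinant has six monomials, each at most `K * D` in modulus. The constant is not sharp,
and only finiteness matters later. -/
lemma norm_triple_le {s g h : Fin 3 → ℂ} {K D : ℝ} (hs : ∀ i, ‖s i‖ ≤ 1) (hg : ∀ i, ‖g i‖ ≤ K)
    (hh : ∀ i, ‖h i‖ ≤ D) : ‖s ⬝ᵥ (g ⨯₃ h)‖ ≤ 6 * K * D := by
  have hK : 0 ≤ K := (norm_nonneg _).trans (hg 0)
  have key : ∀ i j k, ‖s i * (g j * h k - g k * h j)‖ ≤ 2 * (K * D) := by
    intro i j k
    have hm : ∀ j k, ‖g j * h k‖ ≤ K * D := fun j k => by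
      rw [norm_mul]; exact mul_le_mul (hg j) (hh k) (norm_nonneg _) hK
    have h1 : ‖g j * h k - g k * h j‖ ≤ 2 * (K * D) := by
      linarith [norm_sub_le (g j * h k) (g k * h j), hm j k, hm k j]
    rw [norm_mul]
    nlinarith [norm_nonneg (s i), norm_nonneg (g j * h k - g k * h j), hs i]
  have e : s ⬝ᵥ (g ⨯₃ h) = s 0 * (g 1 * h 2 - g 2 * h 1) + s 1 * (g 2 * h 0 - g 0 * h 2)
      + s 2 * (g 0 * h 1 - g 1 * h 0) := by
    simp [cross_apply, dotProduct, Fin.sum_univ_three]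
  rw [e]
  refine (norm_add₃_le).trans ?_
  linarith [key 0 1 2, key 1 2 0, key 2 0 1]

lemma norm_siteGrad_le (a : Config Γ → ℂ) (x : Γ) (σ : Config Γ) (i : Fin 3) :
    ‖siteGrad a x σ i‖ ≤ ‖siteDeriv a x σ‖ := by
  have := (siteDeriv a x σ).le_opNorm (EuclideanSpace.single i 1)
  rwa [PiLp.norm_single, norm_one, mul_one] at this

lemma exists_siteGrad_bound {Λ : Finset Γ} {a : C(Config Γ, ℂ)} (ha : a ∈ smoothLocal Λ) :
    ∃ K : ℝ, ∀ x ∈ Λ, ∀ σ i, ‖siteGrad a x σ i‖ ≤ K := by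
  obtain ⟨F, hF, hFa⟩ := ha
  have h : ∀ (x : Λ) i, ∃ K : ℝ, ∀ σ, ‖siteGrad a x σ i‖ ≤ K := by
    intro x i
    have hc : Continuous fun σ => siteGrad a x σ i := by
      have hamb : ∀ j, Continuous fun σ : Config Γ => ambGrad F x (restr Λ σ) j := fun j =>
        (ambObs hF x j).continuous
      simp only [siteGrad_of_mem hF hFa, dotProduct, spinVec]
      fun_prop
    obtain ⟨K, hK⟩ := isCompact_univ.exists_bound_of_continuousOn hc.continuousOn
    exact ⟨K, fun σ => hK σ trivial⟩
  choose K hK using h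
  refine ⟨∑ x : Λ, ∑ i, |K x i|, fun x hx σ i => (hK ⟨x, hx⟩ i σ).trans ?_⟩
  calc K ⟨x, hx⟩ i ≤ |K ⟨x, hx⟩ i| := le_abs_self _
    _ ≤ ∑ i, |K ⟨x, hx⟩ i| :=
        Finset.single_le_sum (f := fun i => |K ⟨x, hx⟩ i|) (fun j _ => abs_nonneg _)
          (Finset.mem_univ i)
    _ ≤ _ := Finset.single_le_sum (f := fun x : Λ => ∑ i, |K x i|)
          (fun j _ => Finset.sum_nonneg fun i _ => abs_nonneg _) (Finset.mem_univ _)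

lemma exists_enorm_term_le (φ : Potential Γ) {Λ : Finset Γ} (a : smoothObs Γ)
    (ha : (a : C(Config Γ, ℂ)) ∈ smoothLocal Λ) :
    ∃ K : ℝ≥0∞, K ≠ ⊤ ∧ ∀ X, ‖φ.term a X‖ₑ ≤ ∑ _x ∈ Λ ∩ X, K * c1Norm (φ.toFun X) := by
  obtain ⟨K, hK⟩ := exists_siteGrad_bound ha
  refine ⟨ENNReal.ofReal (6 * K), ENNReal.ofReal_ne_top, fun X => ?_⟩
  refine enorm_le_of_forall_apply fun σ => ?_
  have h : φ.term a X σ = _ := poissonFun_eq_sum ha (φ.smooth X) σ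
  rw [h]
  refine (enorm_sum_le _ _).trans (Finset.sum_le_sum fun x hx => ?_)
  have h1 := norm_triple_le (norm_spinVec_le (σ x)) (hK x (Finset.mem_inter.1 hx).1 σ)
    (norm_siteGrad_le (φ.toFun X) x σ)
  have hK0 : 0 ≤ K := (norm_nonneg _).trans (hK x (Finset.mem_inter.1 hx).1 σ 0)
  rw [← ofReal_norm]
  refine (ENNReal.ofReal_le_ofReal h1).trans ?_
  rw [ENNReal.ofReal_mul (by positivity), ofReal_norm]
  gcongr
  exact (le_iSup₂ (f := fun x σ => ‖siteDeriv (φ.toFun X) x σ‖ₑ) x σ).trans le_add_self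

theorem summable_term (φ : Potential Γ) (hC1 : φ.multiC1 < ⊤) (a : smoothObs Γ) :
    Summable (φ.term a) := by
  obtain ⟨Λ, ha⟩ := Set.mem_iUnion.1 a.2
  obtain ⟨K, hK, hle⟩ := exists_enorm_term_le φ a ha
  -- On the singletons of `Λ` the term may involve a single-site potential, invisible to `φ̄`. There
  -- are finitely many of them, so they are set to zero and restored at the end.
  set S : Finset (Finset Γ) := Λ.image fun x => {x} with hS
  have hb : ∀ X, X ∉ S → ‖φ.term a X‖ₑ
      ≤ ∑ x ∈ Λ, Set.indicator {X : Finset Γ | x ∈ X} (fun X => K * c1Norm (φ.multi X)) X := by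
    intro X hX
    by_cases h2 : 2 ≤ X.card
    · have hm : φ.multi X = φ.toFun X := by simp [Potential.multi, h2]
      refine (hle X).trans (le_of_eq ?_)
      rw [← Finset.filter_mem_eq_inter, Finset.sum_filter]
      refine Finset.sum_congr rfl fun x _ => ?_
      simp only [Set.indicator_apply, Set.mem_ofPred_eq, hm]
    · have hd : Disjoint Λ X := by
        refine Finset.disjoint_left.2 fun x hx hx' => hX ?_
        have : X = {x} := (Finset.eq_of_subset_of_card_le (Finset.singleton_subset_iff.2 hx')
          (by rw [Finset.card_singleton]; omega)).symm
        exact Finset.mem_image.2 ⟨x, hx, this.symm⟩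
      rw [φ.term_eq_zero a ha hd]
      exact enorm_le_of_forall_apply fun σ => by simp
  have hs : Summable fun X => if X ∈ S then 0 else φ.term a X := by
    refine Summable.of_norm (tsum_enorm_ne_top_iff_summable_norm.1 (ne_of_lt ?_))
    calc ∑' X, ‖if X ∈ S then 0 else φ.term a X‖ₑ
        ≤ ∑' X, ∑ x ∈ Λ,
          Set.indicator {X : Finset Γ | x ∈ X} (fun X => K * c1Norm (φ.multi X)) X := by
          refine ENNReal.tsum_le_tsum fun X => ?_
          by_cases hX : X ∈ S
          · rw [if_pos hX]
            exact enorm_le_of_forall_apply fun σ => by simp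
          · simpa [hX] using hb X hX
      _ = ∑ x ∈ Λ, ∑' X : {X : Finset Γ // x ∈ X}, K * c1Norm (φ.multi X) := by
          rw [Summable.tsum_finsetSum fun _ _ => ENNReal.summable]
          refine Finset.sum_congr rfl fun x _ => ?_
          exact (tsum_subtype {X : Finset Γ | x ∈ X} fun X => K * c1Norm (φ.multi X)).symm
      _ ≤ ∑ x ∈ Λ, K * φ.multiC1 := by
          refine Finset.sum_le_sum fun x _ => ?_
          rw [ENNReal.tsum_mul_left]
          gcongr
          exact le_iSup (fun x => ∑' X : {X : Finset Γ // x ∈ X}, c1Norm (φ.multi X)) x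
      _ < ⊤ := by
          rw [Finset.sum_const, nsmul_eq_mul]
          exact ENNReal.mul_lt_top (by simp) (ENNReal.mul_lt_top hK.lt_top hC1)
  refine (summable_congr_cofinite ?_).1 hs
  refine (S.finite_toSet.subset fun X hX => ?_)
  by_contra h
  exact hX (if_neg h)

/-! ### Rotations of one spin -/

/-- The vector product of `ℝ³`. -/
def crossE (u v : E3) : E3 := WithLp.toLp 2 (u.ofLp ⨯₃ v.ofLp)

/-- Rodrigues' formula for the rotation of `v` about the unit vector `u` by the angle `θ`. -/
def rotVec (u : E3) (θ : ℝ) (v : E3) : E3 :=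
  Real.cos θ • v + Real.sin θ • crossE u v + ((1 - Real.cos θ) * inner ℝ u v) • u

lemma inner_eq_sum (u v : E3) : inner ℝ u v = u 0 * v 0 + u 1 * v 1 + u 2 * v 2 := by
  simp [PiLp.inner_apply, Fin.sum_univ_three, mul_comm]

lemma crossE_apply (u v : E3) : crossE u v 0 = u 1 * v 2 - u 2 * v 1 ∧
    crossE u v 1 = u 2 * v 0 - u 0 * v 2 ∧ crossE u v 2 = u 0 * v 1 - u 1 * v 0 := by
  simp [crossE, cross_apply]

lemma coord_sq_sum (u : S2) : (u : E3) 0 ^ 2 + (u : E3) 1 ^ 2 + (u : E3) 2 ^ 2 = 1 := by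
  have h := inner_eq_sum (u : E3) u
  rw [real_inner_self_eq_norm_sq] at h
  have hn : ‖(u : E3)‖ = 1 := by simp
  rw [hn] at h
  linarith

lemma rotVec_apply (u : E3) (θ : ℝ) (v : E3) (i : Fin 3) : rotVec u θ v i
    = Real.cos θ * v i + Real.sin θ * crossE u v i
      + (1 - Real.cos θ) * (u 0 * v 0 + u 1 * v 1 + u 2 * v 2) * u i := by
  simp [rotVec, inner_eq_sum]

lemma E3_ext {u v : E3} (h0 : u 0 = v 0) (h1 : u 1 = v 1) (h2 : u 2 = v 2) : u = v := by
  ext i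
  fin_cases i
  exacts [h0, h1, h2]

/-- Besides the addition formulas this uses `u × (u × v) = (u·v) u - |u|² v`; the multiples of `hu`
are the places where `|u|² = 1` enters. -/
lemma rotVec_add_angle (u : S2) (θ η : ℝ) (v : E3) :
    rotVec u (θ + η) v = rotVec u θ (rotVec u η v) := by
  have hu := coord_sq_sum u
  have key : ∀ i, rotVec u (θ + η) v i = rotVec u θ (rotVec u η v) i := by
    intro i
    fin_cases i <;>
    simp only [rotVec_apply, crossE_apply, Real.cos_add, Real.sin_add, Fin.zero_eta, Fin.mk_one,
      Fin.reduceFinMk]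
    · linear_combination (Real.sin θ * Real.sin η * v 0 - (1 - Real.cos θ) * (1 - Real.cos η) *
        ((u : E3) 0 * v 0 + (u : E3) 1 * v 1 + (u : E3) 2 * v 2) * (u : E3) 0) * hu
    · linear_combination (Real.sin θ * Real.sin η * v 1 - (1 - Real.cos θ) * (1 - Real.cos η) *
        ((u : E3) 0 * v 0 + (u : E3) 1 * v 1 + (u : E3) 2 * v 2) * (u : E3) 1) * hu
    · linear_combination (Real.sin θ * Real.sin η * v 2 - (1 - Real.cos θ) * (1 - Real.cos η) *
        ((u : E3) 0 * v 0 + (u : E3) 1 * v 1 + (u : E3) 2 * v 2) * (u : E3) 2) * hu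
  exact E3_ext (key 0) (key 1) (key 2)

lemma norm_rotVec (u : S2) (θ : ℝ) (v : E3) : ‖rotVec u θ v‖ = ‖v‖ := by
  have hu := coord_sq_sum u
  have hs := Real.sin_sq_add_cos_sq θ
  rw [← sq_eq_sq₀ (norm_nonneg _) (norm_nonneg _), ← real_inner_self_eq_norm_sq,
    ← real_inner_self_eq_norm_sq, inner_eq_sum, inner_eq_sum]
  simp only [rotVec_apply, crossE_apply]
  linear_combination (Real.sin θ ^ 2 * (v 0 ^ 2 + v 1 ^ 2 + v 2 ^ 2) + (1 - Real.cos θ) ^ 2 *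
    ((u : E3) 0 * v 0 + (u : E3) 1 * v 1 + (u : E3) 2 * v 2) ^ 2) * hu +
    (v 0 ^ 2 + v 1 ^ 2 + v 2 ^ 2 -
      ((u : E3) 0 * v 0 + (u : E3) 1 * v 1 + (u : E3) 2 * v 2) ^ 2) * hs

lemma hasDerivAt_rotVec (u : S2) (θ : ℝ) (v : E3) :
    HasDerivAt (fun θ => rotVec u θ v) (crossE u (rotVec u θ v)) θ := by
  have hu := coord_sq_sum u
  have h : HasDerivAt (fun θ => rotVec u θ v) ((-Real.sin θ) • v + Real.cos θ • crossE u v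
      + ((-(-Real.sin θ)) * inner ℝ (u : E3) v) • (u : E3)) θ := by
    unfold rotVec
    exact (((Real.hasDerivAt_cos θ).smul_const v).add
      ((Real.hasDerivAt_sin θ).smul_const _)).add
      ((((Real.hasDerivAt_cos θ).const_sub 1).mul_const _).smul_const _)
  refine h.congr_deriv ?_
  refine E3_ext ?_ ?_ ?_ <;>
    simp only [PiLp.add_apply, PiLp.smul_apply, smul_eq_mul, inner_eq_sum, rotVec_apply,
      crossE_apply]
  · linear_combination (Real.sin θ * v 0) * hu
  · linear_combination (Real.sin θ * v 1) * hu
  · linear_combination (Real.sin θ * v 2) * hu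

lemma rotVec_zero (u v : E3) : rotVec u 0 v = v := by simp [rotVec]

/-- The rotation about `u` by the angle `θ` as a linear isometry. -/
def rotIsom (u : S2) (θ : ℝ) : E3 →ₗᵢ[ℝ] E3 where
  toFun := rotVec u θ
  map_add' v w := by
    refine E3_ext ?_ ?_ ?_ <;> simp only [PiLp.add_apply, rotVec_apply, crossE_apply] <;> ring
  map_smul' c v := by
    refine E3_ext ?_ ?_ ?_ <;>
      simp only [PiLp.smul_apply, smul_eq_mul, rotVec_apply, crossE_apply, RingHom.id_apply] <;>
      ring
  norm_map' := norm_rotVec u θ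

/-- A linear isometry acts on the sphere. -/
def sphereMap (R : E3 →ₗᵢ[ℝ] E3) : C(S2, S2) :=
  ⟨fun s => ⟨R s, by simp⟩, by fun_prop⟩

@[simp]
lemma coe_sphereMap (R : E3 →ₗᵢ[ℝ] E3) (s : S2) : ((sphereMap R s : S2) : E3) = R s := rfl

lemma continuous_rotVec (u : E3) : Continuous fun p : ℝ × E3 => rotVec u p.1 p.2 := by
  have h : Continuous fun v : E3 => crossE u v := by
    simp only [crossE, cross_apply]
    fun_prop
  unfold rotVec
  fun_prop

/-- The rotation of the spin at `x` about `u` by the angle `θ`. -/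
def siteRot (x : Γ) (u : S2) (θ : ℝ) : C(Config Γ, Config Γ) :=
  ⟨fun σ => Function.update σ x (sphereMap (rotIsom u θ) (σ x)), by fun_prop⟩

lemma siteRot_apply (x : Γ) (u : S2) (θ : ℝ) (σ : Config Γ) :
    siteRot x u θ σ = Function.update σ x (sphereMap (rotIsom u θ) (σ x)) := rfl

lemma siteRot_zero (x : Γ) (u : S2) (σ : Config Γ) : siteRot x u 0 σ = σ := by
  have : sphereMap (rotIsom u 0) (σ x) = σ x := Subtype.ext (rotVec_zero _ _)
  rw [siteRot_apply, this, Function.update_eq_self]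

lemma siteRot_add (x : Γ) (u : S2) (θ η : ℝ) (σ : Config Γ) :
    siteRot x u (θ + η) σ = siteRot x u θ (siteRot x u η σ) := by
  have : sphereMap (rotIsom u (θ + η)) (σ x)
      = sphereMap (rotIsom u θ) (sphereMap (rotIsom u η) (σ x)) :=
    Subtype.ext (rotVec_add_angle _ _ _ _)
  simp [siteRot_apply, this]

lemma continuous_siteRot (x : Γ) (u : S2) :
    Continuous fun p : ℝ × Config Γ => siteRot x u p.1 p.2 := by
  have h : Continuous fun p : ℝ × Config Γ => sphereMap (rotIsom u p.1) (p.2 x) := by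
    refine Continuous.subtype_mk ((continuous_rotVec (u : E3)).comp
      (f := fun p : ℝ × Config Γ => (p.1, (p.2 x : E3))) ?_) _
    fun_prop
  exact continuous_snd.update x h

lemma smoothLocal_siteRot {Λ : Finset Γ} {b : C(Config Γ, ℂ)} (hb : b ∈ smoothLocal Λ) (x : Γ)
    (u : S2) (θ : ℝ) : b.comp (siteRot x u θ) ∈ smoothLocal Λ := by
  obtain ⟨F, hF, hFb⟩ := hb
  refine ⟨fun v => F fun y => if (y : Γ) = x then rotIsom u θ (v y) else v y, hF.comp ?_, ?_⟩
  · refine contDiff_pi.2 fun y => ?_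
    split_ifs
    · exact (rotIsom u θ).contDiff.comp (contDiff_apply ℝ E3 y)
    · exact contDiff_apply ℝ E3 y
  · intro σ
    rw [ContinuousMap.comp_apply, hFb]
    congr 1
    funext y
    by_cases h : (y : Γ) = x
    · subst h; simp [restr, siteRot_apply]
    · simp [restr, siteRot_apply, h]

lemma siteDeriv_eq_sum (a : Config Γ → ℂ) (x : Γ) (σ : Config Γ) (w : E3) :
    siteDeriv a x σ w = ∑ i, (w i : ℂ) * siteGrad a x σ i := by
  have hw : w = ∑ j : Fin 3, w j • EuclideanSpace.single j (1 : ℝ) := by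
    ext k
    fin_cases k <;> simp [Fin.sum_univ_three]
  conv_lhs => rw [hw]
  simp [siteGrad]

/-- The spin moves with velocity `u × s`, and `∇b · (u × s) = -s · (u × ∇b)`, whence the minus sign:
up to sign, `u·σ_x` is the Hamiltonian of the rotations about `u`. -/
lemma hasDerivAt_siteRot {Λ : Finset Γ} {b : C(Config Γ, ℂ)} (hb : b ∈ smoothLocal Λ) (x : Γ)
    (u : S2) (θ : ℝ) (σ : Config Γ) :
    HasDerivAt (fun θ => b (siteRot x u θ σ))
      (-poissonFun (spinObs x (u : E3)) b (siteRot x u θ σ)) θ := by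
  have h1 := hasFDerivAt_site hb x (siteRot x u θ σ)
  have hx : ((siteRot x u θ σ x : S2) : E3) = rotVec u θ (σ x : E3) := by
    simp [siteRot_apply, rotIsom]
  rw [hx] at h1
  have h2 := h1.comp_hasDerivAt θ (hasDerivAt_rotVec u θ (σ x : E3))
  have hf : (fun v : E3 => b (Function.update (siteRot x u θ σ) x (radial v)))
      ∘ (fun θ => rotVec u θ (σ x : E3)) = fun θ => b (siteRot x u θ σ) := by
    funext η
    have : radial (rotVec u η (σ x : E3)) = sphereMap (rotIsom u η) (σ x) :=
      radial_self (sphereMap (rotIsom u η) (σ x))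
    simp [siteRot_apply, this]
  rw [hf] at h2
  refine h2.congr_deriv ?_
  rw [poissonFun_spinObs hb, siteDeriv_eq_sum, ← hx]
  simp [Fin.sum_univ_three, dotProduct, cross_apply, spinVec, complexVec, crossE_apply]
  ring

/-- The component of the spin at `x` in the direction `u`, as a smooth observable. -/
def spinSmooth (x : Γ) (u : E3) : smoothObs Γ := ⟨spinObs x u, mem_smoothObs (spinObs_mem x u)⟩

lemma continuous_comp_siteRot (f : C(Config Γ, ℂ)) (x : Γ) (u : S2) :
    Continuous fun θ : ℝ => f.comp (siteRot x u θ) :=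
  ContinuousMap.continuous_of_continuous_uncurry _ (f.continuous.comp (continuous_siteRot x u))

lemma continuous_neg_comp_siteRot (f : C(Config Γ, ℂ)) (x : Γ) (u : S2) :
    Continuous fun θ : ℝ => -(f.comp (siteRot x u θ)) :=
  (continuous_comp_siteRot f x u).neg

/-- The fundamental theorem of calculus along the rotation flow, as an integral with values in `C(Ω,
ℂ)`, so that every continuous linear functional passes through it. -/
lemma comp_siteRot_sub (b : smoothObs Γ) (x : Γ) (u : S2) (θ : ℝ) :
    (b : C(Config Γ, ℂ)).comp (siteRot x u θ) - b
      = ∫ τ in (0 : ℝ)..θ,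
        -((poisson (spinSmooth x (u : E3)) b : C(Config Γ, ℂ)).comp (siteRot x u τ)) := by
  obtain ⟨Λ, hb⟩ := Set.mem_iUnion.1 b.2
  have hc := continuous_neg_comp_siteRot (poisson (spinSmooth x (u : E3)) b : C(Config Γ, ℂ)) x u
  ext σ
  have h1 := (ContinuousMap.evalCLM ℝ σ : C(Config Γ, ℂ) →L[ℝ] ℂ).intervalIntegral_comp_comm
    (hc.intervalIntegrable (μ := volume) 0 θ)
  have h2 := intervalIntegral.integral_eq_sub_of_hasDerivAt
    (fun τ _ => hasDerivAt_siteRot hb x u τ σ)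
    (((ContinuousMap.evalCLM ℝ σ : C(Config Γ, ℂ) →L[ℝ] ℂ).continuous.comp
      hc).intervalIntegrable 0 θ)
  rw [siteRot_zero] at h2
  exact h2.symm.trans h1

lemma clm_comp_siteRot_sub (ν : C(Config Γ, ℂ) →L[ℂ] ℂ) (b : smoothObs Γ) (x : Γ) (u : S2)
    (θ : ℝ) :
    ν ((b : C(Config Γ, ℂ)).comp (siteRot x u θ)) - ν b
      = ∫ τ in (0 : ℝ)..θ,
        -ν ((poisson (spinSmooth x (u : E3)) b : C(Config Γ, ℂ)).comp (siteRot x u τ)) := by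
  have hc := continuous_neg_comp_siteRot (poisson (spinSmooth x (u : E3)) b : C(Config Γ, ℂ)) x u
  rw [← map_sub, comp_siteRot_sub, ← ContinuousLinearMap.intervalIntegral_comp_comm _
    (hc.intervalIntegrable 0 θ)]
  simp only [map_neg]

/-! ### The uniform measure on the sphere -/

/-- The uniform probability measure on the sphere. -/
def unif : Measure S2 :=
  ((volume : Measure E3).toSphere Set.univ)⁻¹ • (volume : Measure E3).toSphere

instance : IsProbabilityMeasure unif := by
  have : NeZero (volume : Measure E3).toSphere := ⟨Measure.toSphere_ne_zero _⟩
  exact isProbabilityMeasureSMul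

instance : unif.IsOpenPosMeasure :=
  Measure.isOpenPosMeasure_smul _ (ENNReal.inv_ne_zero.2 (measure_ne_top _ _))

open scoped Pointwise in
-- The surface measure of `s` is a multiple of the volume of the cone over `s`, and a linear
-- isometry maps cones to cones while preserving Lebesgue measure.
lemma map_sphereMap_unif (R : E3 →ₗᵢ[ℝ] E3) : unif.map (sphereMap R) = unif := by
  set R' := R.toLinearIsometryEquiv rfl with hR'
  have hmeas : Measurable (sphereMap R) := (sphereMap R).continuous.measurable
  have hRR : ∀ v, R' v = R v := fun v => rfl
  rw [unif, Measure.map_smul]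
  congr 1
  ext s hs
  rw [Measure.map_apply hmeas hs, Measure.toSphere_apply' _ (hmeas hs),
    Measure.toSphere_apply' _ hs]
  congr 1
  rw [← R'.measurePreserving.measure_preimage_emb R'.toHomeomorph.measurableEmbedding
    (Set.Ioo (0 : ℝ) 1 • ((↑) '' s : Set E3))]
  congr 1
  ext v
  simp only [Set.mem_smul, Set.mem_image, Set.mem_preimage]
  constructor
  · rintro ⟨r, hr, _, ⟨t, ht, rfl⟩, rfl⟩
    exact ⟨r, hr, _, ⟨_, ht, rfl⟩, by simp [hRR]⟩
  · rintro ⟨r, hr, _, ⟨t, ht, rfl⟩, h⟩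
    refine ⟨r, hr, R'.symm t, ⟨⟨R'.symm t, by simp⟩, ?_, rfl⟩, ?_⟩
    · have : sphereMap R ⟨R'.symm t, by simp⟩ = t :=
        Subtype.ext (R'.apply_symm_apply (t : E3))
      rwa [this]
    · apply R'.injective
      rw [← h]
      simp

/-- Integration of continuous functions on a compact space. -/
def integralCLM {X E : Type*} [TopologicalSpace X] [CompactSpace X] [MeasurableSpace X]
    [OpensMeasurableSpace X] [NormedAddCommGroup E] [NormedSpace ℂ E]
    [SecondCountableTopologyEither X E]
    (μ : Measure X) [IsProbabilityMeasure μ] : C(X, E) →L[ℂ] E :=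
  LinearMap.mkContinuous
    { toFun := fun f => ∫ x, f x ∂μ
      map_add' := fun f g => integral_add
        (f.continuous.integrable_of_hasCompactSupport (.of_compactSpace _))
        (g.continuous.integrable_of_hasCompactSupport (.of_compactSpace _))
      map_smul' := fun c f => integral_smul c _ } 1 fun f => by
    have := norm_integral_le_of_norm_le_const (μ := μ) (f := f) (C := ‖f‖)
      (ae_of_all _ f.norm_coe_le_norm)
    simpa using this

lemma integralCLM_apply {X E : Type*} [TopologicalSpace X] [CompactSpace X] [MeasurableSpace X]
    [OpensMeasurableSpace X] [NormedAddCommGroup E] [NormedSpace ℂ E]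
    [SecondCountableTopologyEither X E]
    (μ : Measure X) [IsProbabilityMeasure μ] (f : C(X, E)) :
    integralCLM μ f = ∫ x, f x ∂μ := rfl

/-! ### The product measure -/

/-- The product of the uniform measures of the sites. -/
def prodUnif (Γ : Type*) : Measure (Config Γ) := Measure.infinitePi fun _ => unif

instance : IsProbabilityMeasure (prodUnif Γ) := by
  unfold prodUnif; infer_instance

lemma map_siteRot_prodUnif (x : Γ) (u : S2) (θ : ℝ) :
    (prodUnif Γ).map (siteRot x u θ) = prodUnif Γ := by
  have hm : ∀ y : Γ, Measurable (if y = x then (sphereMap (rotIsom u θ) : S2 → S2) else id) := by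
    intro y
    split_ifs
    · exact (sphereMap (rotIsom u θ)).continuous.measurable
    · exact measurable_id
  have h := Measure.infinitePi_map_pi (fun _ : Γ => unif) hm
  have h1 : (fun (σ : Config Γ) y => (if y = x then (sphereMap (rotIsom u θ) : S2 → S2) else id)
      (σ y)) = siteRot x u θ := by
    funext σ y
    by_cases hy : y = x
    · subst hy; simp [siteRot_apply]
    · simp [siteRot_apply, hy]
  have h2 : (fun y : Γ => unif.map (if y = x then (sphereMap (rotIsom u θ) : S2 → S2) else id))
      = fun _ => unif := by
    funext y
    split_ifs
    · exact map_sphereMap_unif _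
    · exact Measure.map_id
  rw [h1, h2] at h
  exact h

section Countable

variable [Countable Γ]

lemma integral_comp_siteRot (f : C(Config Γ, ℂ)) (x : Γ) (u : S2) (θ : ℝ) :
    ∫ σ, f (siteRot x u θ σ) ∂prodUnif Γ = ∫ σ, f σ ∂prodUnif Γ := by
  conv_rhs => rw [← map_siteRot_prodUnif x u θ]
  rw [integral_map (siteRot x u θ).continuous.aemeasurable f.continuous.aestronglyMeasurable]

lemma integral_poisson_spinSmooth (b : smoothObs Γ) (x : Γ) (u : S2) :
    ∫ σ, (poisson (spinSmooth x (u : E3)) b : C(Config Γ, ℂ)) σ ∂prodUnif Γ = 0 := by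
  -- By invariance of the measure the left side vanishes and the integrand on the right is constant
  -- in time, so any nonzero angle would do.
  have h := clm_comp_siteRot_sub (integralCLM (prodUnif Γ)) b x u 1
  simp only [integralCLM_apply, ContinuousMap.comp_apply, integral_comp_siteRot] at h
  simpa using h

lemma integrable_prodUnif (f : C(Config Γ, ℂ)) : Integrable (fun σ => f σ) (prodUnif Γ) :=
  f.continuous.integrable_of_hasCompactSupport (.of_compactSpace _)

/-- The unit vectors of the coordinate axes. -/
def axis (i : Fin 3) : S2 := ⟨EuclideanSpace.single i 1, by simp⟩

/-- Integration by parts: write `∂_iF {s_i, b} = {s_i, ∂_iF b} - b {s_i, ∂_iF}`. The first term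
integrates to zero by rotation invariance, and the second sums to zero over `i`. -/
lemma integral_poissonFun {Λ : Finset Γ} {a b : C(Config Γ, ℂ)} (ha : a ∈ smoothLocal Λ)
    (hb : b ∈ smoothLocal Λ) : ∫ σ, poissonFun a b σ ∂prodUnif Γ = 0 := by
  obtain ⟨F, hF, hFa⟩ := ha
  have hterm : ∀ (x : Λ) (i : Fin 3) σ,
      ambObs hF x i σ * poissonFun (spinObs (x : Γ) (EuclideanSpace.single i 1)) b σ
      = (poisson (spinSmooth (x : Γ) (axis i : E3))
          ⟨_, mem_smoothObs (smoothLocal_mul (ambObs_mem hF x i) hb)⟩ : C(Config Γ, ℂ)) σ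
        - (b * (poisson (spinSmooth (x : Γ) (axis i : E3))
          ⟨_, mem_smoothObs (ambObs_mem hF x i)⟩ : C(Config Γ, ℂ))) σ := by
    intro x i σ
    have h : poissonFun (spinObs (x : Γ) (axis i : E3)) (ambObs hF x i * b : C(Config Γ, ℂ)) σ
        = _ := poissonFun_mul_right
      (smoothLocal_mono (Finset.singleton_subset_iff.2 x.2) (spinObs_mem (x : Γ) (axis i : E3)))
      (ambObs_mem hF x i) hb σ
    exact eq_sub_of_add_eq h.symm
  simp only [poissonFun_eq_sum_spinObs hF hFa hb, hterm]
  rw [integral_finsetSum]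
  · refine Finset.sum_eq_zero fun x _ => ?_
    have hsum : ∀ σ, ∑ i, (b * (poisson (spinSmooth (x : Γ) (axis i : E3))
          ⟨_, mem_smoothObs (ambObs_mem hF x i)⟩ : C(Config Γ, ℂ))) σ = 0 := by
      intro σ
      have h := sum_poissonFun_spinObs_ambObs hF x σ
      rw [← mul_zero (b σ), ← h, Finset.mul_sum]
      rfl
    simp only [Finset.sum_sub_distrib, hsum, sub_zero]
    rw [integral_finsetSum _ fun i _ => integrable_prodUnif _]
    exact Finset.sum_eq_zero fun i _ => integral_poisson_spinSmooth _ _ _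
  · exact fun x _ => integrable_finsetSum _ fun i _ =>
      (integrable_prodUnif _).sub (integrable_prodUnif _)

end Countable

/-! ### Existence of KMS states -/

/-- Each element is a combination, with unimodular coefficients, of four positive elements of no
larger norm; this gives the 4. The sharp constant is not needed, only uniformity in the state. -/
lemma norm_state_le {ω : C(Config Γ, ℂ) →ₚ[ℂ] ℂ} (hω : IsState ω) (f : C(Config Γ, ℂ)) :
    ‖ω f‖ ≤ 4 * ‖f‖ := by
  obtain ⟨y, hy0, hyn, hy⟩ := CStarAlgebra.exists_sum_four_nonneg f
  conv_lhs => rw [hy]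
  simp only [map_sum, map_smul]
  refine (norm_sum_le _ _).trans ?_
  have h : ∀ i ∈ (Finset.univ : Finset (Fin 4)), ‖Complex.I ^ (i : ℕ) • ω (y i)‖ ≤ ‖f‖ := by
    intro i _
    rw [norm_smul, norm_pow, Complex.norm_I, one_pow, one_mul]
    have := ω.norm_apply_le_of_nonneg (y i) (hy0 i)
    rw [show ω 1 = 1 from hω, norm_one, one_mul] at this
    exact this.trans (hyn i)
  simpa using Finset.sum_le_sum h

namespace Potential

/-- The energy of the finite region `Λ`, with free boundary conditions. -/
def energy (φ : Potential Γ) (Λ : Finset Γ) : C(Config Γ, ℂ) := ∑ X ∈ Λ.powerset, φ.toFun X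

lemma energy_mem (φ : Potential Γ) (Λ : Finset Γ) : φ.energy Λ ∈ smoothLocal Λ :=
  smoothLocal_sum _ fun X hX => smoothLocal_mono (Finset.mem_powerset.1 hX) (φ.smooth X)

/-- The Boltzmann weight of the finite region `Λ`. -/
def weight (φ : Potential Γ) (β : ℝ) (Λ : Finset Γ) : C(Config Γ, ℂ) :=
  expObs ((-β : ℂ) • φ.energy Λ)

lemma weight_mem (φ : Potential Γ) (β : ℝ) (Λ : Finset Γ) : φ.weight β Λ ∈ smoothLocal Λ :=
  smoothLocal_exp (smoothLocal_smul _ (φ.energy_mem Λ))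

lemma isSelfAdjoint_energy (φ : Potential Γ) (Λ : Finset Γ) : IsSelfAdjoint (φ.energy Λ) :=
  isSelfAdjoint_sum _ fun X _ => φ.selfAdjoint X

end Potential

lemma apply_eq_ofReal_re {f : C(Config Γ, ℂ)} (hf : IsSelfAdjoint f) (σ : Config Γ) :
    f σ = ((f σ).re : ℂ) := by
  have h := congrArg (fun g : C(Config Γ, ℂ) => g σ) hf.star_eq
  exact (Complex.conj_eq_iff_re.1 h).symm

lemma Potential.weight_apply (φ : Potential Γ) (β : ℝ) (Λ : Finset Γ) (σ : Config Γ) :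
    φ.weight β Λ σ = (Real.exp (-β * (φ.energy Λ σ).re) : ℝ) := by
  have h := apply_eq_ofReal_re (φ.isSelfAdjoint_energy Λ) σ
  simp only [Potential.weight, expObs_apply, ContinuousMap.smul_apply, smul_eq_mul]
  rw [h]
  push_cast
  simp

lemma poisson_weight (φ : Potential Γ) (β : ℝ) {Λ : Finset Γ} {a b : C(Config Γ, ℂ)}
    (ha : a ∈ smoothLocal Λ) (hb : b ∈ smoothLocal Λ) (σ : Config Γ) :
    poissonFun a (b * φ.weight β Λ : C(Config Γ, ℂ)) σ = φ.weight β Λ σ * (poissonFun a b σ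
      - β * (b σ * ∑ X ∈ Λ.powerset, poissonFun a (φ.toFun X) σ)) := by
  rw [poissonFun_mul_right ha hb (φ.weight_mem β Λ), Potential.weight,
    poissonFun_exp_right ha (smoothLocal_smul _ (φ.energy_mem Λ)),
    poissonFun_smul_right _ ha (φ.energy_mem Λ), Potential.energy,
    poissonFun_sum_right _ ha fun X hX => smoothLocal_mono (Finset.mem_powerset.1 hX) (φ.smooth X)]
  ring

/-- A finite family of regions lies in the powerset of its union. Hence an unconditional sum over
all regions is the limit of its partial sums over `X ⊆ Λ`. -/
lemma tendsto_powerset_atTop :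
    Tendsto (fun Λ : Finset Γ => Λ.powerset) atTop (atTop : Filter (Finset (Finset Γ))) := by
  refine tendsto_atTop.2 fun S => ?_
  filter_upwards [eventually_ge_atTop (S.sup id)] with Λ hΛ
  intro X hX
  exact Finset.mem_powerset.2 ((Finset.le_sup (f := id) hX).trans hΛ)

/-- The partition function of the finite region `Λ`. -/
def Potential.partition (φ : Potential Γ) (β : ℝ) (Λ : Finset Γ) : ℝ :=
  ∫ σ, Real.exp (-β * (φ.energy Λ σ).re) ∂prodUnif Γ

lemma Potential.integral_weight (φ : Potential Γ) (β : ℝ) (Λ : Finset Γ) :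
    ∫ σ, φ.weight β Λ σ ∂prodUnif Γ = φ.partition β Λ := by
  simp only [φ.weight_apply]
  exact integral_ofReal

section Countable

variable [Countable Γ]

lemma Potential.partition_pos (φ : Potential Γ) (β : ℝ) (Λ : Finset Γ) :
    0 < φ.partition β Λ := by
  refine integral_exp_pos ?_
  refine Continuous.integrable_of_hasCompactSupport ?_ (.of_compactSpace _)
  have := (φ.energy Λ).continuous
  fun_prop

/-- The Gibbs state of the finite region `Λ` with free boundary conditions. -/
def Potential.gibbs (φ : Potential Γ) (β : ℝ) (Λ : Finset Γ) : C(Config Γ, ℂ) →ₚ[ℂ] ℂ :=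
  PositiveLinearMap.mk₀
    (((φ.partition β Λ : ℂ)⁻¹ • (integralCLM (prodUnif Γ) : C(Config Γ, ℂ) →L[ℂ] ℂ)).toLinearMap ∘ₗ
      LinearMap.mulLeft ℂ (φ.weight β Λ)) fun f hf => by
    have h1 : 0 ≤ ∫ σ, (φ.weight β Λ * f) σ ∂prodUnif Γ := by
      refine integral_nonneg fun σ => ?_
      refine mul_nonneg ?_ (hf σ)
      rw [φ.weight_apply]
      exact Complex.zero_le_real.2 (Real.exp_pos _).le
    have h2 : (0 : ℂ) ≤ (φ.partition β Λ : ℂ)⁻¹ := by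
      rw [← Complex.ofReal_inv]
      exact Complex.zero_le_real.2 (inv_pos.2 (φ.partition_pos β Λ)).le
    exact mul_nonneg h2 h1

lemma Potential.gibbs_apply (φ : Potential Γ) (β : ℝ) (Λ : Finset Γ) (f : C(Config Γ, ℂ)) :
    φ.gibbs β Λ f
      = (φ.partition β Λ : ℂ)⁻¹ * ∫ σ, φ.weight β Λ σ * f σ ∂prodUnif Γ := rfl

lemma Potential.isState_gibbs (φ : Potential Γ) (β : ℝ) (Λ : Finset Γ) :
    IsState (φ.gibbs β Λ) := by
  unfold IsState
  rw [φ.gibbs_apply]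
  simp only [ContinuousMap.one_apply, mul_one]
  rw [φ.integral_weight, inv_mul_cancel₀]
  exact_mod_cast (φ.partition_pos β Λ).ne'

/-- Apply the vanishing of integrated brackets to `a` and `b` times the Boltzmann weight;
differentiating the weight produces `-β` times the truncated derivation. -/
lemma Potential.gibbs_poisson (φ : Potential Γ) (β : ℝ) {Λ : Finset Γ} (a b : smoothObs Γ)
    (ha : (a : C(Config Γ, ℂ)) ∈ smoothLocal Λ) (hb : (b : C(Config Γ, ℂ)) ∈ smoothLocal Λ) :
    φ.gibbs β Λ (poisson a b : C(Config Γ, ℂ))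
      = β * φ.gibbs β Λ ((b : C(Config Γ, ℂ)) * ∑ X ∈ Λ.powerset, φ.term a X) := by
  have h := integral_poissonFun ha (smoothLocal_mul hb (φ.weight_mem β Λ))
  simp only [poisson_weight φ β ha hb] at h
  have hs : ∀ σ, φ.weight β Λ σ * (poissonFun (a : C(Config Γ, ℂ)) (b : C(Config Γ, ℂ)) σ
      - β * ((b : C(Config Γ, ℂ)) σ * ∑ X ∈ Λ.powerset,
        poissonFun (a : C(Config Γ, ℂ)) (φ.toFun X) σ))
      = (φ.weight β Λ * (poisson a b : C(Config Γ, ℂ))) σ - β * (φ.weight β Λ *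
        ((b : C(Config Γ, ℂ)) * ∑ X ∈ Λ.powerset, φ.term a X)) σ := by
    intro σ
    have h1 : (∑ X ∈ Λ.powerset, φ.term a X) σ
        = ∑ X ∈ Λ.powerset, poissonFun (a : C(Config Γ, ℂ)) (φ.toFun X) σ := by
      rw [ContinuousMap.sum_apply]; rfl
    have h2 : (poisson a b : C(Config Γ, ℂ)) σ
        = poissonFun (a : C(Config Γ, ℂ)) (b : C(Config Γ, ℂ)) σ := rfl
    simp only [ContinuousMap.mul_apply, h1, h2]
    ring
  simp only [hs] at h
  rw [integral_sub (integrable_prodUnif _) ((integrable_prodUnif _).const_mul _),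
    integral_const_mul, sub_eq_zero] at h
  rw [φ.gibbs_apply, φ.gibbs_apply, ← mul_assoc, mul_comm (β : ℂ), mul_assoc]
  congr 1

theorem exists_isKMS (φ : Potential Γ) (hs : ∀ a : smoothObs Γ, Summable (φ.term a)) (β : ℝ) :
    ∃ ω : C(Config Γ, ℂ) →ₚ[ℂ] ℂ, IsKMS β φ.deriv ω := by
  -- An ultrafilter finer than `atTop` makes all the bounded families of expectations converge
  -- simultaneously; linearity and positivity pass to the limit.
  set U : Ultrafilter (Finset Γ) := Ultrafilter.of atTop with hU
  have hUle : (U : Filter (Finset Γ)) ≤ atTop := Ultrafilter.of_le _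
  have hlim : ∀ f, ∃ z, Tendsto (fun Λ => φ.gibbs β Λ f) U (𝓝 z) := by
    intro f
    obtain ⟨z, -, hz⟩ := (isCompact_closedBall (0 : ℂ) (4 * ‖f‖)).ultrafilter_le_nhds
      (U.map fun Λ => φ.gibbs β Λ f) (by
        rw [Ultrafilter.coe_map, le_principal_iff, mem_map]
        refine Filter.univ_mem' fun Λ => ?_
        simpa using norm_state_le (φ.isState_gibbs β Λ) f)
    exact ⟨z, hz⟩
  choose z hz using hlim
  let ω : C(Config Γ, ℂ) →ₚ[ℂ] ℂ := PositiveLinearMap.mk₀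
    { toFun := z
      map_add' := fun f g => tendsto_nhds_unique (hz (f + g))
        (((hz f).add (hz g)).congr fun Λ => (map_add _ _ _).symm)
      map_smul' := fun c f => tendsto_nhds_unique (hz (c • f))
        (((hz f).const_smul c).congr fun Λ => (map_smul _ _ _).symm) }
    fun f hf => ge_of_tendsto' (hz f) fun Λ => (φ.gibbs β Λ).map_nonneg hf
  have hω : ∀ f, ω f = z f := fun f => rfl
  refine ⟨ω, ?_, fun a b => ?_⟩
  · exact tendsto_nhds_unique (hz 1)
      (tendsto_const_nhds.congr fun Λ => (φ.isState_gibbs β Λ).symm)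
  · obtain ⟨Λ₀, ha, hb⟩ := exists_common a b
    set D : Finset Γ → C(Config Γ, ℂ) := fun Λ => ∑ X ∈ Λ.powerset, φ.term a X with hD
    have hDlim : Tendsto D U (𝓝 (φ.deriv a)) :=
      ((hs a).hasSum.comp tendsto_powerset_atTop).mono_left hUle
    -- State and observable vary together with `Λ`; the uniform bound on states lets `D Λ` be
    -- exchanged for its norm limit.
    have h0 : Tendsto (fun Λ => φ.gibbs β Λ ((b : C(Config Γ, ℂ)) * (D Λ - φ.deriv a))) U
        (𝓝 0) := by
      have h1 : Tendsto (fun Λ => 4 * ‖(b : C(Config Γ, ℂ)) * (D Λ - φ.deriv a)‖) U (𝓝 0) := by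
        have := ((tendsto_const_nhds (x := (b : C(Config Γ, ℂ)))).mul
          (hDlim.sub_const (φ.deriv a))).norm.const_mul 4
        simpa using this
      exact squeeze_zero_norm (fun Λ => norm_state_le (φ.isState_gibbs β Λ) _) h1
    have h2 : Tendsto (fun Λ => φ.gibbs β Λ ((b : C(Config Γ, ℂ)) * D Λ)) U
        (𝓝 (ω ((b : C(Config Γ, ℂ)) * φ.deriv a))) := by
      have := h0.add (hz ((b : C(Config Γ, ℂ)) * φ.deriv a))
      rw [zero_add] at this
      refine this.congr fun Λ => ?_
      rw [← map_add]
      congr 1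
      ring
    refine tendsto_nhds_unique (hz _) ((h2.const_mul (β : ℂ)).congr' ?_)
    filter_upwards [hUle (eventually_ge_atTop Λ₀)] with Λ hΛ
    exact (φ.gibbs_poisson β a b (smoothLocal_mono hΛ ha) (smoothLocal_mono hΛ hb)).symm

end Countable

/-! ### Density of the smooth local observables -/

variable (Γ) in
/-- The smooth local observables form a star subalgebra. -/
def smoothSubalgebra : StarSubalgebra ℂ C(Config Γ, ℂ) where
  carrier := smoothObs Γ
  mul_mem' {a b} ha hb := by
    obtain ⟨Λ, h1, h2⟩ := exists_common ⟨a, ha⟩ ⟨b, hb⟩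
    exact mem_smoothObs (smoothLocal_mul h1 h2)
  add_mem' {a b} ha hb := by
    obtain ⟨Λ, h1, h2⟩ := exists_common ⟨a, ha⟩ ⟨b, hb⟩
    exact mem_smoothObs (smoothLocal_add h1 h2)
  algebraMap_mem' c := mem_smoothObs (smoothLocal_const ∅ c)
  star_mem' {a} ha := by
    obtain ⟨Λ, h⟩ := Set.mem_iUnion.1 ha
    exact mem_smoothObs (smoothLocal_star h)

lemma dense_smoothObs : Dense (smoothObs Γ) := by
  have h := ContinuousMap.starSubalgebra_topologicalClosure_eq_top_of_separatesPoints
    (smoothSubalgebra Γ) (by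
      intro σ τ hne
      obtain ⟨x, hx⟩ := Function.ne_iff.1 hne
      have hx' : (σ x : E3) ≠ τ x := fun h => hx (Subtype.ext h)
      -- The component along `σ_x - τ_x` takes values at `σ` and `τ` that differ by `|σ_x - τ_x|²`,
      -- so Stone–Weierstrass applies.
      refine ⟨_, ⟨spinObs x ((σ x : E3) - τ x), mem_smoothObs (spinObs_mem x _), rfl⟩, ?_⟩
      intro h
      have h' : inner ℝ ((σ x : E3) - τ x) (σ x : E3) = inner ℝ ((σ x : E3) - τ x) (τ x : E3) :=
        Complex.ofReal_injective h
      rw [← sub_eq_zero, ← inner_sub_right, inner_self_eq_zero, sub_eq_zero] at h'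
      exact hx' h')
  have h2 : (closure (smoothObs Γ) : Set C(Config Γ, ℂ)) = Set.univ :=
    congrArg (fun S : StarSubalgebra ℂ C(Config Γ, ℂ) => (S : Set C(Config Γ, ℂ))) h
  exact dense_iff_closure_eq.2 h2

/-! ### The energy of one site -/

/-- The part of the potential which involves the site `x`. -/
def Potential.sitePart (φ : Potential Γ) (x : Γ) (X : Finset Γ) : C(Config Γ, ℂ) :=
  if x ∈ X then φ.toFun X else 0

/-- The energy of the spin at `x` in the field of the other spins. -/
def Potential.siteEnergy (φ : Potential Γ) (x : Γ) : C(Config Γ, ℂ) := ∑' X, φ.sitePart x X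

lemma Potential.sitePart_mem (φ : Potential Γ) (x : Γ) (X : Finset Γ) :
    φ.sitePart x X ∈ smoothLocal X := by
  unfold Potential.sitePart
  split_ifs
  exacts [φ.smooth X, smoothLocal_zero X]

lemma enorm_zero_observable : ‖(0 : C(Config Γ, ℂ))‖ₑ = 0 :=
  le_antisymm (enorm_le_of_forall_apply fun σ => by simp) zero_le

lemma exp_log_three_mul (n : ℕ) (hn : 1 ≤ n) :
    Real.exp (Real.log 3 * ((n : ℝ) - 1)) = 3 ^ (n - 1) := by
  obtain ⟨m, rfl⟩ := Nat.exists_eq_add_of_le' hn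
  simp only [Nat.cast_add, Nat.cast_one, add_sub_cancel_right, Nat.add_sub_cancel]
  rw [mul_comm, Real.exp_nat_mul, Real.exp_log (by norm_num)]

lemma Potential.tsum_multi_le (φ : Potential Γ) (x : Γ) :
    ∑' X : {X : Finset Γ // x ∈ X}, (3 ^ (X.1.card - 1) : ℝ≥0∞) * ‖φ.multi X‖ₑ
      ≤ φ.multiNorm (Real.log 3) := by
  refine le_trans (ENNReal.tsum_le_tsum fun X => ?_)
    (le_iSup (fun x => ∑' X : {X : Finset Γ // x ∈ X},
      ENNReal.ofReal (Real.exp (Real.log 3 * ((X.1.card : ℝ) - 1))) * ‖φ.multi X‖ₑ) x)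
  rw [exp_log_three_mul _ (Finset.card_pos.2 ⟨x, X.2⟩), ENNReal.ofReal_pow (by norm_num)]
  simp

lemma Potential.summable_sitePart (φ : Potential Γ) (hφ : φ.multiNorm (Real.log 3) < ⊤) (x : Γ) :
    Summable (φ.sitePart x) := by
  have hs : Summable fun X => if X = {x} then 0 else φ.sitePart x X := by
    refine Summable.of_norm (tsum_enorm_ne_top_iff_summable_norm.1 (ne_of_lt ?_))
    refine lt_of_le_of_lt ?_ ((φ.tsum_multi_le x).trans_lt hφ)
    refine le_of_le_of_eq (ENNReal.tsum_le_tsum fun X => ?_) (tsum_subtype {X : Finset Γ | x ∈ X}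
      fun X => (3 ^ (X.card - 1) : ℝ≥0∞) * ‖φ.multi X‖ₑ).symm
    by_cases hX : X = {x}
    · rw [if_pos hX, enorm_zero_observable]
      exact zero_le
    rw [if_neg hX]
    by_cases hx : x ∈ X
    · have hcard : 2 ≤ X.card := by
        by_contra h
        exact hX (Finset.eq_of_subset_of_card_le (Finset.singleton_subset_iff.2 hx)
          (by rw [Finset.card_singleton]; omega)).symm
      rw [Set.indicator_of_mem (by exact hx), Potential.sitePart, if_pos hx, Potential.multi,
        if_pos hcard]
      exact le_mul_of_one_le_left' (one_le_pow₀ (by norm_num))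
    · rw [Potential.sitePart, if_neg hx, enorm_zero_observable]
      exact zero_le
  refine (summable_congr_cofinite ?_).1 hs
  refine ((Set.finite_singleton ({x} : Finset Γ)).subset fun X hX => ?_)
  by_contra h
  exact hX (if_neg h)

lemma Potential.isSelfAdjoint_siteEnergy (φ : Potential Γ) (x : Γ) :
    IsSelfAdjoint (φ.siteEnergy x) := by
  have h : ∀ X, star (φ.sitePart x X) = φ.sitePart x X := fun X => by
    unfold Potential.sitePart
    split_ifs
    exacts [(φ.selfAdjoint X).star_eq, star_zero _]
  rw [isSelfAdjoint_iff, Potential.siteEnergy, tsum_star]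
  simp only [h]

lemma poissonFun_spinSmooth_sitePart (φ : Potential Γ) (x : Γ) (u : E3) (X : Finset Γ)
    (σ : Config Γ) :
    poissonFun (spinObs x u) (φ.sitePart x X) σ = φ.term (spinSmooth x u) X σ := by
  by_cases hx : x ∈ X
  · rw [Potential.sitePart, if_pos hx]; rfl
  · rw [Potential.sitePart, if_neg hx, poissonFun_zero_right,
      φ.term_eq_zero (spinSmooth x u) (spinObs_mem x u) (by simpa using hx)]
    rfl

/-! ### Rotation invariance of the reweighted KMS states -/

/-- The energy `H_x` need not be a smooth local observable, so the KMS condition is applied with the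
weight of a finite partial sum. The product rule leaves the tail of `δ(u·σ_x)` as the only error,
and it tends to zero in norm; for the weight itself sup-norm convergence is then enough. -/
lemma kms_mul_poisson_partial {φ : Potential Γ} {β : ℝ} {ω : C(Config Γ, ℂ) →ₚ[ℂ] ℂ}
    (hω : IsKMS β φ.deriv ω) (x : Γ) (u : E3) (b : smoothObs Γ) (S : Finset (Finset Γ)) :
    ω (expObs ((β : ℂ) • ∑ X ∈ S, φ.sitePart x X)
        * (poisson (spinSmooth x u) b : C(Config Γ, ℂ)))
      = β * ω ((b : C(Config Γ, ℂ)) * expObs ((β : ℂ) • ∑ X ∈ S, φ.sitePart x X)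
        * (φ.deriv (spinSmooth x u) - ∑ X ∈ S, φ.term (spinSmooth x u) X)) := by
  obtain ⟨Λb, hb⟩ := Set.mem_iUnion.1 b.2
  set Λ := insert x (Λb ∪ S.sup id) with hΛ
  have hb' : (b : C(Config Γ, ℂ)) ∈ smoothLocal Λ :=
    smoothLocal_mono (Finset.subset_union_left.trans (Finset.subset_insert _ _)) hb
  have hx : spinObs x u ∈ smoothLocal Λ :=
    smoothLocal_mono (by simp [hΛ]) (spinObs_mem x u)
  have hpart : ∀ X ∈ S, φ.sitePart x X ∈ smoothLocal Λ := fun X hX =>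
    smoothLocal_mono ((Finset.le_sup (f := id) hX).trans
      (Finset.subset_union_right.trans (Finset.subset_insert _ _))) (φ.sitePart_mem x X)
  have hsum := smoothLocal_sum S hpart
  set w := expObs ((β : ℂ) • ∑ X ∈ S, φ.sitePart x X) with hw
  have hwm : w ∈ smoothLocal Λ := smoothLocal_exp (smoothLocal_smul _ hsum)
  have h := hω.2 (spinSmooth x u) ⟨_, mem_smoothObs (smoothLocal_mul hb' hwm)⟩
  have hp : (poisson (spinSmooth x u) ⟨_, mem_smoothObs (smoothLocal_mul hb' hwm)⟩ :
      C(Config Γ, ℂ)) = w * (poisson (spinSmooth x u) b : C(Config Γ, ℂ))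
        + (β : ℂ) • ((b : C(Config Γ, ℂ)) * w * ∑ X ∈ S, φ.term (spinSmooth x u) X) := by
    ext σ
    have h1 : poissonFun (spinObs x u) ((b : C(Config Γ, ℂ)) * w : C(Config Γ, ℂ)) σ = _ :=
      poissonFun_mul_right hx hb' hwm σ
    refine h1.trans ?_
    rw [hw, poissonFun_exp_right hx (smoothLocal_smul _ hsum),
      poissonFun_smul_right _ hx hsum, poissonFun_sum_right S hx hpart]
    simp only [poissonFun_spinSmooth_sitePart]
    have h2 : poissonFun (spinObs x u) (b : C(Config Γ, ℂ)) σ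
      = (poisson (spinSmooth x u) b : C(Config Γ, ℂ)) σ := rfl
    rw [h2]
    simp only [ContinuousMap.add_apply, ContinuousMap.mul_apply, ContinuousMap.smul_apply,
      ContinuousMap.sum_apply, smul_eq_mul]
    ring
  rw [hp, map_add, map_smul, smul_eq_mul] at h
  rw [mul_sub, map_sub, mul_sub]
  exact eq_sub_of_add_eq h

/-- The functional `f ↦ ω (exp (β H_x) f)`. -/
def reweighted (φ : Potential Γ) (β : ℝ) (x : Γ) (ω : C(Config Γ, ℂ) →ₚ[ℂ] ℂ) :
    C(Config Γ, ℂ) →L[ℂ] ℂ where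
  toFun f := ω (expObs ((β : ℂ) • φ.siteEnergy x) * f)
  map_add' f g := by rw [mul_add, map_add]
  map_smul' c f := by rw [mul_smul_comm, map_smul]; rfl
  cont := (map_continuous ω).comp (continuous_const.mul continuous_id)

lemma reweighted_apply (φ : Potential Γ) (β : ℝ) (x : Γ) (ω : C(Config Γ, ℂ) →ₚ[ℂ] ℂ)
    (f : C(Config Γ, ℂ)) :
    reweighted φ β x ω f = ω (expObs ((β : ℂ) • φ.siteEnergy x) * f) := rfl

lemma reweighted_poisson {φ : Potential Γ} (hφ : φ.multiNorm (Real.log 3) < ⊤)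
    (hs : ∀ a : smoothObs Γ, Summable (φ.term a)) {β : ℝ} {ω : C(Config Γ, ℂ) →ₚ[ℂ] ℂ}
    (hω : IsKMS β φ.deriv ω) (x : Γ) (u : E3) (b : smoothObs Γ) :
    reweighted φ β x ω (poisson (spinSmooth x u) b : C(Config Γ, ℂ)) = 0 := by
  have hc := map_continuous ω
  have hw : Tendsto (fun S : Finset (Finset Γ) => expObs ((β : ℂ) • ∑ X ∈ S, φ.sitePart x X)) atTop
      (𝓝 (expObs ((β : ℂ) • φ.siteEnergy x))) :=
    (continuous_expObs.tendsto _).comp (Tendsto.const_smul (φ.summable_sitePart hφ x).hasSum (β : ℂ))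
  have hd : Tendsto (fun S : Finset (Finset Γ) => φ.deriv (spinSmooth x u)
      - ∑ X ∈ S, φ.term (spinSmooth x u) X) atTop (𝓝 0) := by
    have := (tendsto_const_nhds (x := φ.deriv (spinSmooth x u))).sub
      (hs (spinSmooth x u)).hasSum
    rwa [show φ.deriv (spinSmooth x u) - ∑' X, φ.term (spinSmooth x u) X = 0 from sub_self _]
      at this
  have h1 := (hc.tendsto _).comp (hw.mul_const (poisson (spinSmooth x u) b : C(Config Γ, ℂ)))
  have h2 := ((hc.tendsto _).comp
    ((hw.const_mul (b : C(Config Γ, ℂ))).mul hd)).const_mul (β : ℂ)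
  rw [mul_zero, map_zero, mul_zero] at h2
  refine tendsto_nhds_unique h1 (h2.congr fun S => ?_)
  exact (kms_mul_poisson_partial hω x u b S).symm

/-- A flow commutes with its generator: the derivative at `η = 0` of `b` along the rotation by `θ +
η` is computed in two ways through the group law. -/
lemma poisson_comp_siteRot {Λ : Finset Γ} {b : C(Config Γ, ℂ)} (hb : b ∈ smoothLocal Λ) (x : Γ)
    (u : S2) (θ : ℝ) :
    (poisson (spinSmooth x (u : E3)) ⟨b, mem_smoothObs hb⟩ : C(Config Γ, ℂ)).comp (siteRot x u θ)
      = poisson (spinSmooth x (u : E3)) ⟨_, mem_smoothObs (smoothLocal_siteRot hb x u θ)⟩ := by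
  ext σ
  have h1 := (hasDerivAt_siteRot hb x u (θ + 0) σ).comp_const_add θ 0
  have h2 := hasDerivAt_siteRot (smoothLocal_siteRot hb x u θ) x u 0 σ
  simp only [ContinuousMap.comp_apply, ← siteRot_add] at h2
  have := h1.unique h2
  rw [add_zero, siteRot_zero] at this
  exact neg_injective this

lemma reweighted_comp_siteRot {φ : Potential Γ} (hφ : φ.multiNorm (Real.log 3) < ⊤)
    (hs : ∀ a : smoothObs Γ, Summable (φ.term a)) {β : ℝ} {ω : C(Config Γ, ℂ) →ₚ[ℂ] ℂ}
    (hω : IsKMS β φ.deriv ω) (x : Γ) (u : S2) (θ : ℝ) (f : C(Config Γ, ℂ)) :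
    reweighted φ β x ω (f.comp (siteRot x u θ)) = reweighted φ β x ω f := by
  set ν := reweighted φ β x ω
  have hclosed : IsClosed {f : C(Config Γ, ℂ) | ν (f.comp (siteRot x u θ)) = ν f} :=
    isClosed_eq (ν.continuous.comp (ContinuousMap.continuous_precomp _)) ν.continuous
  -- For smooth `b` the derivative along the flow is itself a bracket with `u·σ_x`, hence killed by
  -- `ν`; density does the rest.
  refine hclosed.closure_subset_iff.2 (fun b hb => ?_) (dense_smoothObs f)
  obtain ⟨Λ, hb'⟩ := Set.mem_iUnion.1 hb
  have h := clm_comp_siteRot_sub ν ⟨b, hb⟩ x u θ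
  have h0 : ∀ τ, ν ((poisson (spinSmooth x (u : E3)) ⟨b, hb⟩ : C(Config Γ, ℂ)).comp
      (siteRot x u τ)) = 0 := fun τ => by
    rw [poisson_comp_siteRot hb']
    exact reweighted_poisson hφ hs hω x u _
  simp only [h0, neg_zero, intervalIntegral.integral_zero] at h
  exact sub_eq_zero.1 h

/-! ### Averaging one spin -/

/-- The configuration with the spin at `x` replaced by `t`. -/
def siteSet (x : Γ) (t : S2) : C(Config Γ, Config Γ) :=
  ⟨fun σ => Function.update σ x t, by fun_prop⟩

/-- The family of observables obtained by freezing the spin at `x`. -/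
def siteFamily (x : Γ) (f : C(Config Γ, ℂ)) : C(S2, C(Config Γ, ℂ)) where
  toFun t := f.comp (siteSet x t)
  continuous_toFun := ContinuousMap.continuous_of_continuous_uncurry _
    (f.continuous.comp (continuous_snd.update x continuous_fst))

lemma siteFamily_apply (x : Γ) (f : C(Config Γ, ℂ)) (t : S2) (σ : Config Γ) :
    siteFamily x f t σ = f (Function.update σ x t) := rfl

/-- The average of an observable over the spin at `x`. -/
def siteAvg (x : Γ) (f : C(Config Γ, ℂ)) : C(Config Γ, ℂ) := ∫ t, siteFamily x f t ∂unif

lemma integrable_unif {E : Type*} [NormedAddCommGroup E] (F : C(S2, E)) :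
    Integrable (fun t => F t) unif :=
  F.continuous.integrable_of_hasCompactSupport (.of_compactSpace _)

lemma integral_apply_config (F : C(S2, C(Config Γ, ℂ))) (σ : Config Γ) :
    (∫ t, F t ∂unif) σ = ∫ t, F t σ ∂unif :=
  ((ContinuousMap.evalCLM ℂ σ : C(Config Γ, ℂ) →L[ℂ] ℂ).integral_comp_comm
    (integrable_unif F)).symm

lemma siteAvg_apply (x : Γ) (f : C(Config Γ, ℂ)) (σ : Config Γ) :
    siteAvg x f σ = ∫ t, f (Function.update σ x t) ∂unif :=
  integral_apply_config _ σ

lemma clm_siteAvg (ν : C(Config Γ, ℂ) →L[ℂ] ℂ) (x : Γ) (f : C(Config Γ, ℂ)) :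
    ν (siteAvg x f) = ∫ t, ν (siteFamily x f t) ∂unif :=
  (ν.integral_comp_comm (integrable_unif _)).symm

lemma exists_unit_orthogonal (t : S2) : ∃ u : S2, inner ℝ (u : E3) (t : E3) = 0 := by
  have ht : (t : E3) ≠ 0 := ne_zero_of_mem_unit_sphere t
  have hrank : Module.finrank ℝ (ℝ ∙ (t : E3))ᗮ = 2 :=
    Submodule.finrank_orthogonal_span_singleton (n := 2) (_i := ⟨by simp⟩) ht
  have : Nontrivial (ℝ ∙ (t : E3))ᗮ := Module.nontrivial_of_finrank_pos (R := ℝ) (by omega)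
  obtain ⟨v, hv⟩ := exists_ne (0 : (ℝ ∙ (t : E3))ᗮ)
  have hv0 : (v : E3) ≠ 0 := fun h => hv (Subtype.ext h)
  have h := Submodule.mem_orthogonal_singleton_iff_inner_left.1 v.2
  refine ⟨⟨‖(v : E3)‖⁻¹ • (v : E3), by simp [norm_smul, hv0]⟩, ?_⟩
  simp [inner_smul_left, h]

/-- The half-turn about the bisector `s + t` exchanges `s` and `t`; for antipodal points any axis
orthogonal to `s` works. Half-turns alone therefore act transitively. -/
lemma exists_rotVec_pi (s t : S2) : ∃ u : S2, rotVec u Real.pi (s : E3) = t := by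
  have hpi : ∀ u : E3, rotVec u Real.pi (s : E3) = -(s : E3) + (2 * inner ℝ u (s : E3)) • u := by
    intro u
    simp only [rotVec, Real.cos_pi, Real.sin_pi]
    module
  by_cases h : (s : E3) + t = 0
  · obtain ⟨u, hu⟩ := exists_unit_orthogonal s
    refine ⟨u, ?_⟩
    rw [hpi, hu, mul_zero, zero_smul, add_zero]
    exact (eq_neg_of_add_eq_zero_right h).symm
  · have hn : ‖(s : E3) + t‖ ≠ 0 := norm_ne_zero_iff.2 h
    refine ⟨⟨‖(s : E3) + t‖⁻¹ • ((s : E3) + t),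
      by rw [mem_sphere_zero_iff_norm, norm_smul, norm_inv, norm_norm, inv_mul_cancel₀ hn]⟩, ?_⟩
    have hs : ‖(s : E3)‖ = 1 := by simp
    have ht : ‖(t : E3)‖ = 1 := by simp
    have h1 : 2 * inner ℝ ((s : E3) + t) (s : E3) = ‖(s : E3) + t‖ ^ 2 := by
      rw [norm_add_sq_real, inner_add_left, real_inner_self_eq_norm_sq, hs, ht,
        real_inner_comm (s : E3) (t : E3)]
      ring
    rw [hpi]
    simp only [inner_smul_left, smul_smul, RCLike.conj_to_real]
    have h2 : 2 * (‖(s : E3) + t‖⁻¹ * inner ℝ ((s : E3) + t) (s : E3)) * ‖(s : E3) + t‖⁻¹ = 1 := by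
      calc _ = (2 * inner ℝ ((s : E3) + t) (s : E3)) * (‖(s : E3) + t‖⁻¹ * ‖(s : E3) + t‖⁻¹) := by
            ring
        _ = 1 := by rw [h1]; field_simp
    rw [h2, one_smul]
    abel

/-- A bump function around the diagonal of the sphere, of width `δ`. -/
def bump (δ : ℝ) (s t : S2) : ℝ := max 0 (δ - dist s t)

lemma bump_nonneg (δ : ℝ) (s t : S2) : 0 ≤ bump δ s t := le_max_left _ _

lemma bump_sphereMap (δ : ℝ) (R : E3 →ₗᵢ[ℝ] E3) (s t : S2) :
    bump δ (sphereMap R s) (sphereMap R t) = bump δ s t := by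
  have : dist (sphereMap R s) (sphereMap R t) = dist s t := R.isometry.dist_eq _ _
  rw [bump, bump, this]

lemma bump_eq_zero {δ : ℝ} {s t : S2} (h : δ ≤ dist s t) : bump δ s t = 0 :=
  max_eq_left (by linarith)

lemma continuous_bump {X : Type*} [TopologicalSpace X] {f g : X → S2} (δ : ℝ)
    (hf : Continuous f) (hg : Continuous g) : Continuous fun z => bump δ (f z) (g z) := by
  unfold bump
  fun_prop

lemma exists_sphereMap_rotIsom (s t : S2) :
    ∃ u : S2, sphereMap (rotIsom u Real.pi) s = t := by
  obtain ⟨u, hu⟩ := exists_rotVec_pi s t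
  exact ⟨u, Subtype.ext hu⟩

lemma integral_bump_eq (δ : ℝ) (s s' : S2) :
    ∫ t, bump δ s t ∂unif = ∫ t, bump δ s' t ∂unif := by
  obtain ⟨u, rfl⟩ := exists_sphereMap_rotIsom s s'
  conv_rhs => rw [← map_sphereMap_unif (rotIsom u Real.pi)]
  rw [integral_map (sphereMap _).continuous.aemeasurable
    (by exact (continuous_bump δ continuous_const continuous_id).aestronglyMeasurable)]
  simp only [bump_sphereMap]

lemma integral_bump_pos {δ : ℝ} (hδ : 0 < δ) (s : S2) : 0 < ∫ t, bump δ s t ∂unif := by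
  refine Continuous.integral_pos_of_hasCompactSupport_nonneg_nonzero (x := s)
    (continuous_bump δ continuous_const continuous_id)
    (.of_compactSpace _) (fun t => bump_nonneg δ s t) ?_
  simp [bump, hδ.le, hδ.ne']

/-- The bump around `t`, as a function of the spin at `x`. -/
def bumpFamily (δ : ℝ) (x : Γ) : C(S2, C(Config Γ, ℂ)) where
  toFun t := ⟨fun σ => (bump δ (σ x) t : ℂ), Complex.continuous_ofReal.comp
    (continuous_bump δ (continuous_apply x) continuous_const)⟩
  continuous_toFun := ContinuousMap.continuous_of_continuous_uncurry _
    (Complex.continuous_ofReal.comp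
      (continuous_bump δ ((continuous_apply x).comp continuous_snd) continuous_fst))

lemma bumpFamily_apply (δ : ℝ) (x : Γ) (t : S2) (σ : Config Γ) :
    bumpFamily δ x t σ = (bump δ (σ x) t : ℂ) := rfl

lemma integral_bumpFamily (δ : ℝ) (x : Γ) (s : S2) :
    ∫ t, bumpFamily (Γ := Γ) δ x t ∂unif
      = ContinuousMap.const (Config Γ) ((∫ t, bump δ s t ∂unif : ℝ) : ℂ) := by
  ext σ
  rw [integral_apply_config]
  simp only [bumpFamily_apply, ContinuousMap.const_apply]
  rw [integral_complex_ofReal, integral_bump_eq δ (σ x) s]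

lemma exists_modulus (x : Γ) (f : C(Config Γ, ℂ)) {η : ℝ} (hη : 0 < η) :
    ∃ δ > 0, ∀ (σ : Config Γ) (t : S2), dist (σ x) t < δ →
      ‖f (Function.update σ x t) - f σ‖ ≤ η := by
  have huc := CompactSpace.uniformContinuous_of_continuous (siteFamily x f).continuous
  obtain ⟨δ, hδ, h⟩ := Metric.uniformContinuous_iff.1 huc η hη
  refine ⟨δ, hδ, fun σ t ht => ?_⟩
  have h1 := h (a := t) (b := σ x) (by rw [dist_comm]; exact ht)
  rw [dist_eq_norm] at h1
  have h2 := (ContinuousMap.norm_coe_le_norm (siteFamily x f t - siteFamily x f (σ x)) σ).trans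
    h1.le
  rwa [ContinuousMap.sub_apply, siteFamily_apply, siteFamily_apply, Function.update_eq_self] at h2

/-- With the spin at `x` frozen in `f`, only the bump feels a rotation of that spin. Transitivity
makes the left side independent of the centre of the bump, and averaging over the centre turns the
bump into its constant integral. -/
lemma clm_bumpFamily_mul {ν : C(Config Γ, ℂ) →L[ℂ] ℂ} {x : Γ}
    (hν : ∀ (u : S2) (f : C(Config Γ, ℂ)), ν (f.comp (siteRot x u Real.pi)) = ν f)
    (f : C(Config Γ, ℂ)) (δ : ℝ) (s t : S2) :
    ν (bumpFamily δ x t * siteFamily x f t)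
      = ((∫ t, bump δ s t ∂unif : ℝ) : ℂ) * ν (siteFamily x f t) := by
  have hinv : ∀ t', ν (bumpFamily δ x t' * siteFamily x f t)
      = ν (bumpFamily δ x t * siteFamily x f t) := by
    intro t'
    obtain ⟨u, hu⟩ := exists_sphereMap_rotIsom t' t
    rw [← hν u (bumpFamily δ x t * siteFamily x f t)]
    congr 1
    ext σ
    simp only [ContinuousMap.comp_apply, ContinuousMap.mul_apply, bumpFamily_apply,
      siteFamily_apply, siteRot_apply, Function.update_self, Function.update_idem]
    rw [← hu, bump_sphereMap]
  have h1 : ∫ t', ν (bumpFamily δ x t' * siteFamily x f t) ∂unif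
      = ν ((∫ t', bumpFamily δ x t' ∂unif) * siteFamily x f t) := by
    have := (ν.comp ((ContinuousLinearMap.mul ℂ C(Config Γ, ℂ)).flip
      (siteFamily x f t))).integral_comp_comm (integrable_unif (bumpFamily δ x))
    simpa [mul_comm] using this
  simp only [hinv, integral_const, probReal_univ, one_smul] at h1
  rw [h1, integral_bumpFamily δ x s]
  exact map_smul ν ((∫ t, bump δ s t ∂unif : ℝ) : ℂ) (siteFamily x f t)

/-- This is uniqueness of the invariant measure on the sphere, without averaging over the rotation
group. Smearing `f` with narrow normalized bumps in the spin at `x` approximates `f` uniformly,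
while `ν` of the smeared function equals `ν (siteAvg x f)`. -/
theorem clm_siteAvg_eq {ν : C(Config Γ, ℂ) →L[ℂ] ℂ} {x : Γ}
    (hν : ∀ (u : S2) (f : C(Config Γ, ℂ)), ν (f.comp (siteRot x u Real.pi)) = ν f)
    (f : C(Config Γ, ℂ)) : ν (siteAvg x f) = ν f := by
  have key : ∀ η > 0, ‖ν (siteAvg x f) - ν f‖ ≤ ‖ν‖ * η := by
    intro η hη
    obtain ⟨δ, hδ, hmod⟩ := exists_modulus x f hη
    set c := ∫ t, bump δ (axis 0) t ∂unif with hc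
    have hc0 : 0 < c := integral_bump_pos hδ _
    have hc0' : (c : ℂ) ≠ 0 := by exact_mod_cast hc0.ne'
    set F : C(S2, C(Config Γ, ℂ)) := bumpFamily δ x * siteFamily x f with hF
    have h1 : ν (∫ t, F t ∂unif) = c * ν (siteAvg x f) := by
      rw [clm_siteAvg, ← integral_const_mul, ← ν.integral_comp_comm (integrable_unif F)]
      exact integral_congr_ae (ae_of_all _ fun t => clm_bumpFamily_mul hν f δ (axis 0) t)
    have h2 : ‖(c : ℂ)⁻¹ • ∫ t, F t ∂unif - f‖ ≤ η := by
      refine (ContinuousMap.norm_le _ hη.le).2 fun σ => ?_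
      have hcσ : ∫ t, bump δ (σ x) t ∂unif = c := integral_bump_eq _ _ _
      have hib : Integrable (fun t => bump δ (σ x) t) unif :=
        (continuous_bump δ continuous_const continuous_id).integrable_of_hasCompactSupport (.of_compactSpace _)
      have hib' : Integrable (fun t => (bump δ (σ x) t : ℂ)) unif := hib.ofReal
      have hiF : Integrable (fun t => F t σ) unif :=
        ((ContinuousMap.evalCLM ℂ σ : C(Config Γ, ℂ) →L[ℂ] ℂ).integrable_comp
          (integrable_unif F))
      have h3 : ((c : ℂ)⁻¹ • ∫ t, F t ∂unif - f) σ
          = (c : ℂ)⁻¹ * ∫ t, (bump δ (σ x) t : ℂ) * (f (Function.update σ x t) - f σ) ∂unif := by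
        have h4 : ∫ t, (bump δ (σ x) t : ℂ) * (f (Function.update σ x t) - f σ) ∂unif
            = ∫ t, F t σ ∂unif - c * f σ := by
          rw [← hcσ, ← integral_complex_ofReal, ← integral_mul_const,
            ← integral_sub hiF (hib'.mul_const _)]
          refine integral_congr_ae (ae_of_all _ fun t => ?_)
          exact mul_sub _ _ _
        rw [h4, ContinuousMap.sub_apply, ContinuousMap.smul_apply, integral_apply_config,
          smul_eq_mul]
        field_simp
      rw [h3, norm_mul, norm_inv, Complex.norm_real, Real.norm_of_nonneg hc0.le]
      have h5 : ‖∫ t, (bump δ (σ x) t : ℂ) * (f (Function.update σ x t) - f σ) ∂unif‖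
          ≤ ∫ t, bump δ (σ x) t * η ∂unif := by
        refine norm_integral_le_of_norm_le (hib.mul_const η) (ae_of_all _ fun t => ?_)
        rw [norm_mul, Complex.norm_real, Real.norm_of_nonneg (bump_nonneg _ _ _)]
        rcases lt_or_ge (dist (σ x) t) δ with h | h
        · exact mul_le_mul_of_nonneg_left (hmod σ t h) (bump_nonneg _ _ _)
        · simp [bump_eq_zero h]
      rw [integral_mul_const, hcσ] at h5
      calc c⁻¹ * _ ≤ c⁻¹ * (c * η) := by gcongr
        _ = η := by field_simp
    have h6 : ν (siteAvg x f) - ν f = ν ((c : ℂ)⁻¹ • ∫ t, F t ∂unif - f) := by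
      rw [map_sub, map_smul, h1, smul_eq_mul, inv_mul_cancel_left₀ hc0']
    rw [h6]
    exact (ν.le_opNorm _).trans (by gcongr)
  rw [← sub_eq_zero, ← norm_le_zero_iff]
  refine le_of_forall_pos_le_add fun ε hε => ?_
  have := key (ε / (‖ν‖ + 1)) (by positivity)
  refine this.trans ?_
  rw [zero_add, mul_div_assoc', div_le_iff₀ (by positivity)]
  nlinarith [norm_nonneg ν]

/-! ### The conditional Gibbs expectation of one spin -/

/-- The Boltzmann weight of the spin at `x` in the field of the other spins. -/
def siteWeight (φ : Potential Γ) (β : ℝ) (x : Γ) : C(Config Γ, ℂ) :=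
  expObs ((-β : ℂ) • φ.siteEnergy x)

lemma siteWeight_apply (φ : Potential Γ) (β : ℝ) (x : Γ) (σ : Config Γ) :
    siteWeight φ β x σ = (Real.exp (-(β * (φ.siteEnergy x σ).re)) : ℝ) := by
  have h := apply_eq_ofReal_re (φ.isSelfAdjoint_siteEnergy x) σ
  simp only [siteWeight, expObs_apply, ContinuousMap.smul_apply, smul_eq_mul]
  rw [h]
  push_cast
  simp

lemma expObs_mul_siteWeight (φ : Potential Γ) (β : ℝ) (x : Γ) (f : C(Config Γ, ℂ)) :
    expObs ((β : ℂ) • φ.siteEnergy x) * (siteWeight φ β x * f) = f := by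
  ext σ
  simp only [siteWeight, ContinuousMap.mul_apply, expObs_apply, ContinuousMap.smul_apply,
    ← mul_assoc, ← Complex.exp_add, smul_eq_mul]
  simp

lemma continuous_siteEnergy_update (φ : Potential Γ) (x : Γ) (σ : Config Γ) :
    Continuous fun t => (φ.siteEnergy x (Function.update σ x t)).re :=
  Complex.continuous_re.comp ((φ.siteEnergy x).continuous.comp
    (continuous_const.update x continuous_id))

lemma integral_exp_unif_pos {h : S2 → ℝ} (hh : Continuous h) :
    0 < ∫ t, Real.exp (-h t) ∂unif :=
  integral_exp_pos ((Real.continuous_exp.comp hh.neg).integrable_of_hasCompactSupport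
    (.of_compactSpace _))

lemma siteAvg_siteWeight_apply (φ : Potential Γ) (β : ℝ) (x : Γ) (σ : Config Γ) :
    siteAvg x (siteWeight φ β x) σ
      = (∫ t, Real.exp (-(β * (φ.siteEnergy x (Function.update σ x t)).re)) ∂unif : ℝ) := by
  rw [siteAvg_apply]
  simp only [siteWeight_apply]
  exact integral_complex_ofReal

lemma siteAvg_siteWeight_ne_zero (φ : Potential Γ) (β : ℝ) (x : Γ) (σ : Config Γ) :
    siteAvg x (siteWeight φ β x) σ ≠ 0 := by
  rw [siteAvg_siteWeight_apply]
  exact_mod_cast (integral_exp_unif_pos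
    (continuous_const.mul (continuous_siteEnergy_update φ x σ))).ne'

/-- The conditional Gibbs expectation of the spin at `x`, given the other spins. -/
def siteGibbs (φ : Potential Γ) (β : ℝ) (x : Γ) (f : C(Config Γ, ℂ)) : C(Config Γ, ℂ) :=
  ⟨fun σ => siteAvg x (siteWeight φ β x * f) σ / siteAvg x (siteWeight φ β x) σ,
    (ContinuousMap.continuous _).div (ContinuousMap.continuous _)
      (siteAvg_siteWeight_ne_zero φ β x)⟩

lemma siteAvg_update (x : Γ) (f : C(Config Γ, ℂ)) (σ : Config Γ) (t : S2) :
    siteAvg x f (Function.update σ x t) = siteAvg x f σ := by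
  simp only [siteAvg_apply, Function.update_idem]

lemma siteGibbs_update (φ : Potential Γ) (β : ℝ) (x : Γ) (f : C(Config Γ, ℂ)) (σ : Config Γ)
    (t : S2) : siteGibbs φ β x f (Function.update σ x t) = siteGibbs φ β x f σ := by
  simp only [siteGibbs, ContinuousMap.coe_mk, siteAvg_update]

/-- The Dobrushin–Lanford–Ruelle equation of one site. -/
theorem kms_siteGibbs {φ : Potential Γ} (hφ : φ.multiNorm (Real.log 3) < ⊤)
    (hs : ∀ a : smoothObs Γ, Summable (φ.term a)) {β : ℝ} {ω : C(Config Γ, ℂ) →ₚ[ℂ] ℂ}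
    (hω : IsKMS β φ.deriv ω) (x : Γ) (f : C(Config Γ, ℂ)) :
    ω (siteGibbs φ β x f) = ω f := by
  have hν := fun g => clm_siteAvg_eq (ν := reweighted φ β x ω) (x := x)
    (fun u f => reweighted_comp_siteRot hφ hs hω x u Real.pi f) g
  -- So `ω g` depends only on the average of `e^{-βH_x} g` over the spin at `x`. This average is the
  -- same for `f` and for `siteGibbs φ β x f`, since the latter does not depend on that spin.
  have hω' : ∀ g, ω g = reweighted φ β x ω (siteAvg x (siteWeight φ β x * g)) := fun g => by
    rw [hν, reweighted_apply, expObs_mul_siteWeight]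
  rw [hω' (siteGibbs φ β x f), hω' f]
  congr 1
  ext σ
  have h1 : siteAvg x (siteWeight φ β x * siteGibbs φ β x f) σ
      = siteAvg x (siteWeight φ β x) σ * siteGibbs φ β x f σ := by
    rw [siteAvg_apply, siteAvg_apply, ← integral_mul_const]
    simp only [ContinuousMap.mul_apply, siteGibbs_update]
  rw [h1]
  exact mul_div_cancel₀ _ (siteAvg_siteWeight_ne_zero φ β x σ)

/-! ### Comparison of Gibbs expectations -/

/-- The Gibbs expectation of `F` on one sphere with the energy `h`. -/
def sphereGibbs (h : S2 → ℝ) (F : S2 → ℂ) : ℂ :=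
  (∫ t, (Real.exp (-h t) : ℂ) * F t ∂unif) / (∫ t, Real.exp (-h t) ∂unif : ℝ)

lemma siteGibbs_apply (φ : Potential Γ) (β : ℝ) (x : Γ) (f : C(Config Γ, ℂ)) (σ : Config Γ) :
    siteGibbs φ β x f σ
      = sphereGibbs (fun t => β * (φ.siteEnergy x (Function.update σ x t)).re)
        (fun t => f (Function.update σ x t)) := by
  have h : siteGibbs φ β x f σ
      = siteAvg x (siteWeight φ β x * f) σ / siteAvg x (siteWeight φ β x) σ := rfl
  rw [h, siteAvg_siteWeight_apply, siteAvg_apply, sphereGibbs]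
  simp only [ContinuousMap.mul_apply, siteWeight_apply]

/-- The density of the Gibbs measure on one sphere with the energy `h`. -/
def gibbsDensity (h : S2 → ℝ) (t : S2) : ℝ := Real.exp (-h t) / ∫ t, Real.exp (-h t) ∂unif

lemma gibbsDensity_nonneg {h : S2 → ℝ} (hh : Continuous h) (t : S2) : 0 ≤ gibbsDensity h t :=
  div_nonneg (Real.exp_pos _).le (integral_exp_unif_pos hh).le

lemma continuous_gibbsDensity {h : S2 → ℝ} (hh : Continuous h) : Continuous (gibbsDensity h) := by
  unfold gibbsDensity
  fun_prop

lemma integrable_unif_of_continuous {E : Type*} [NormedAddCommGroup E] {F : S2 → E}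
    (hF : Continuous F) : Integrable F unif :=
  hF.integrable_of_hasCompactSupport (.of_compactSpace _)

lemma integral_gibbsDensity {h : S2 → ℝ} (hh : Continuous h) :
    ∫ t, gibbsDensity h t ∂unif = 1 := by
  unfold gibbsDensity
  rw [integral_div, div_self (integral_exp_unif_pos hh).ne']

lemma sphereGibbs_eq (h : S2 → ℝ) (F : S2 → ℂ) :
    sphereGibbs h F = ∫ t, (gibbsDensity h t : ℂ) * F t ∂unif := by
  unfold sphereGibbs gibbsDensity
  rw [← integral_div]
  refine integral_congr_ae (ae_of_all _ fun t => ?_)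
  push_cast
  ring

/-- One factor `exp D` comes from the Boltzmann weight and one from the normalization. -/
lemma gibbsDensity_le {h h' : S2 → ℝ} (hh : Continuous h) (hh' : Continuous h') {D : ℝ}
    (hD : ∀ t, |h t - h' t| ≤ D) (t : S2) :
    gibbsDensity h t ≤ Real.exp (2 * D) * gibbsDensity h' t := by
  have hZ := integral_exp_unif_pos hh
  have hZ' := integral_exp_unif_pos hh'
  have h1 : ∫ t, Real.exp (-h' t) ∂unif ≤ Real.exp D * ∫ t, Real.exp (-h t) ∂unif := by
    rw [← integral_const_mul]
    refine integral_mono (integrable_unif_of_continuous (by fun_prop))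
      (integrable_unif_of_continuous (by fun_prop)) fun t => ?_
    simp only [← Real.exp_add]
    exact Real.exp_le_exp.2 (by linarith [(abs_le.1 (hD t)).2])
  have h2 : Real.exp (-h t) ≤ Real.exp D * Real.exp (-h' t) := by
    rw [← Real.exp_add]
    exact Real.exp_le_exp.2 (by linarith [(abs_le.1 (hD t)).1])
  unfold gibbsDensity
  rw [div_le_iff₀ hZ]
  calc Real.exp (-h t) ≤ Real.exp D * Real.exp (-h' t) := h2
    _ = Real.exp D * Real.exp (-h' t) / (∫ t, Real.exp (-h' t) ∂unif)
        * ∫ t, Real.exp (-h' t) ∂unif := by field_simp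
    _ ≤ Real.exp D * Real.exp (-h' t) / (∫ t, Real.exp (-h' t) ∂unif)
        * (Real.exp D * ∫ t, Real.exp (-h t) ∂unif) := by gcongr
    _ = _ := by rw [two_mul, Real.exp_add]; ring

lemma abs_gibbsDensity_sub_le {h h' : S2 → ℝ} (hh : Continuous h) (hh' : Continuous h') {D : ℝ}
    (hD : ∀ t, |h t - h' t| ≤ D) (hD1 : 2 * D ≤ 1) (t : S2) :
    |gibbsDensity h t - gibbsDensity h' t| ≤ 4 * D * gibbsDensity h' t := by
  have hD0 : 0 ≤ D := (abs_nonneg _).trans (hD t)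
  have h1 := gibbsDensity_le hh hh' hD t
  have h2 := gibbsDensity_le hh' hh (fun t => by rw [abs_sub_comm]; exact hD t) t
  have hexp : Real.exp (2 * D) - 1 ≤ 4 * D := by
    have := Real.abs_exp_sub_one_le (x := 2 * D) (by rw [abs_of_nonneg (by positivity)]; exact hD1)
    rw [abs_of_nonneg (by positivity : (0 : ℝ) ≤ 2 * D)] at this
    linarith [le_abs_self (Real.exp (2 * D) - 1)]
  have hg := gibbsDensity_nonneg hh' t
  have h3 : Real.exp (-(2 * D)) * gibbsDensity h' t ≤ gibbsDensity h t := by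
    rw [Real.exp_neg, inv_mul_le_iff₀ (Real.exp_pos _)]
    exact h2
  have h4 : 1 - 2 * D ≤ Real.exp (-(2 * D)) := by linarith [Real.add_one_le_exp (-(2 * D))]
  rw [abs_le]
  constructor <;> nlinarith

/-- Change the function first, then the density. Both densities have integral 1, so the constant `F'
s` can be subtracted in the second step; hence only the oscillation of `F'` enters, not its size. -/
lemma norm_sphereGibbs_sub_le {h h' : S2 → ℝ} (hh : Continuous h) (hh' : Continuous h')
    {F F' : S2 → ℂ} (hF : Continuous F) (hF' : Continuous F') {D ε η : ℝ}
    (hD : ∀ t, |h t - h' t| ≤ D) (hD1 : 2 * D ≤ 1) (hε : ∀ t, ‖F t - F' t‖ ≤ ε) (s : S2)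
    (hη : ∀ t, ‖F' t - F' s‖ ≤ η) :
    ‖sphereGibbs h F - sphereGibbs h' F'‖ ≤ ε + 4 * D * η := by
  have hρ := continuous_gibbsDensity hh
  have hρ' := continuous_gibbsDensity hh'
  have hρc : Continuous fun t => (gibbsDensity h t : ℂ) := Complex.continuous_ofReal.comp hρ
  have hρc' : Continuous fun t => (gibbsDensity h' t : ℂ) := Complex.continuous_ofReal.comp hρ'
  have hone : ∫ t, (gibbsDensity h t : ℂ) ∂unif = 1 := by
    rw [integral_complex_ofReal, integral_gibbsDensity hh, Complex.ofReal_one]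
  have hone' : ∫ t, (gibbsDensity h' t : ℂ) ∂unif = 1 := by
    rw [integral_complex_ofReal, integral_gibbsDensity hh', Complex.ofReal_one]
  have key : sphereGibbs h F - sphereGibbs h' F'
      = (∫ t, (gibbsDensity h t : ℂ) * (F t - F' t) ∂unif)
        + ∫ t, ((gibbsDensity h t - gibbsDensity h' t : ℝ) : ℂ) * (F' t - F' s) ∂unif := by
    have e1 : ∫ t, (gibbsDensity h t : ℂ) * (F t - F' t) ∂unif
        = (∫ t, (gibbsDensity h t : ℂ) * F t ∂unif)
          - ∫ t, (gibbsDensity h t : ℂ) * F' t ∂unif := by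
      rw [← integral_sub (integrable_unif_of_continuous (by fun_prop))
        (integrable_unif_of_continuous (by fun_prop))]
      simp only [mul_sub]
    have e2 : ∫ t, ((gibbsDensity h t - gibbsDensity h' t : ℝ) : ℂ) * (F' t - F' s) ∂unif
        = ((∫ t, (gibbsDensity h t : ℂ) * F' t ∂unif) - (∫ t, (gibbsDensity h t : ℂ) ∂unif) * F' s)
          - ((∫ t, (gibbsDensity h' t : ℂ) * F' t ∂unif)
            - (∫ t, (gibbsDensity h' t : ℂ) ∂unif) * F' s) := by
      rw [← integral_mul_const, ← integral_mul_const,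
        ← integral_sub (integrable_unif_of_continuous (by fun_prop))
          (integrable_unif_of_continuous (by fun_prop)),
        ← integral_sub (integrable_unif_of_continuous (by fun_prop))
          (integrable_unif_of_continuous (by fun_prop)),
        ← integral_sub (integrable_unif_of_continuous (by fun_prop))
          (integrable_unif_of_continuous (by fun_prop))]
      refine integral_congr_ae (ae_of_all _ fun t => ?_)
      push_cast
      ring
    rw [e1, e2, sphereGibbs_eq, sphereGibbs_eq, hone, hone']
    ring
  have h1 : ‖∫ t, (gibbsDensity h t : ℂ) * (F t - F' t) ∂unif‖
      ≤ ∫ t, gibbsDensity h t * ε ∂unif := by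
    refine norm_integral_le_of_norm_le (integrable_unif_of_continuous (by fun_prop))
      (ae_of_all _ fun t => ?_)
    rw [norm_mul, Complex.norm_real, Real.norm_of_nonneg (gibbsDensity_nonneg hh t)]
    exact mul_le_mul_of_nonneg_left (hε t) (gibbsDensity_nonneg hh t)
  have h2 : ‖∫ t, ((gibbsDensity h t - gibbsDensity h' t : ℝ) : ℂ) * (F' t - F' s) ∂unif‖
      ≤ ∫ t, gibbsDensity h' t * (4 * D * η) ∂unif := by
    refine norm_integral_le_of_norm_le (integrable_unif_of_continuous (by fun_prop))
      (ae_of_all _ fun t => ?_)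
    rw [norm_mul, Complex.norm_real, Real.norm_eq_abs]
    have h3 := abs_gibbsDensity_sub_le hh hh' hD hD1 t
    calc _ ≤ (4 * D * gibbsDensity h' t) * η :=
          mul_le_mul h3 (hη t) (norm_nonneg _) ((abs_nonneg _).trans h3)
      _ = _ := by ring
  rw [integral_mul_const, integral_gibbsDensity hh, one_mul] at h1
  rw [integral_mul_const, integral_gibbsDensity hh', one_mul] at h2
  rw [key]
  exact (norm_add_le _ _).trans (add_le_add h1 h2)

/-! ### Oscillations -/

/-- The oscillation of an observable with respect to the spin at `y`. -/
def osc (y : Γ) (f : C(Config Γ, ℂ)) : ℝ≥0∞ :=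
  ⨆ σ : Config Γ, ⨆ t : S2, ‖f (Function.update σ y t) - f σ‖ₑ

lemma enorm_sub_le_osc (y : Γ) (f : C(Config Γ, ℂ)) (σ : Config Γ) (t : S2) :
    ‖f (Function.update σ y t) - f σ‖ₑ ≤ osc y f :=
  le_iSup₂ (f := fun (σ : Config Γ) t => ‖f (Function.update σ y t) - f σ‖ₑ) σ t

lemma osc_ne_top (y : Γ) (f : C(Config Γ, ℂ)) : osc y f ≠ ⊤ := by
  refine ne_top_of_le_ne_top (ENNReal.ofReal_ne_top (r := ‖f‖ + ‖f‖)) (iSup₂_le fun σ t => ?_)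
  rw [← ofReal_norm]
  exact ENNReal.ofReal_le_ofReal ((norm_sub_le _ _).trans
    (add_le_add (f.norm_coe_le_norm _) (f.norm_coe_le_norm _)))

lemma norm_sub_le_osc (y : Γ) (f : C(Config Γ, ℂ)) (σ : Config Γ) (t : S2) :
    ‖f (Function.update σ y t) - f σ‖ ≤ (osc y f).toReal := by
  rw [← toReal_enorm]
  exact ENNReal.toReal_mono (osc_ne_top y f) (enorm_sub_le_osc y f σ t)

lemma apply_update_of_notMem {X : Finset Γ} {f : C(Config Γ, ℂ)} (hf : f ∈ smoothLocal X) {y : Γ}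
    (hy : y ∉ X) (σ : Config Γ) (t : S2) : f (Function.update σ y t) = f σ := by
  obtain ⟨F, -, hF⟩ := hf
  rw [hF, hF]
  congr 1
  funext z
  have : (z : Γ) ≠ y := fun h => hy (h ▸ z.2)
  simp [restr, this]

lemma osc_eq_zero {X : Finset Γ} {f : C(Config Γ, ℂ)} (hf : f ∈ smoothLocal X) {y : Γ}
    (hy : y ∉ X) : osc y f = 0 := by
  simp [osc, apply_update_of_notMem hf hy]

lemma enorm_piecewise_sub_le (f : C(Config Γ, ℂ)) (σ τ : Config Γ) (S : Finset Γ) :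
    ‖f (S.piecewise τ σ) - f σ‖ₑ ≤ ∑ y ∈ S, osc y f := by
  induction S using Finset.induction_on with
  | empty => simp
  | insert y S hy ih =>
    rw [Finset.sum_insert hy, Finset.piecewise_insert]
    have : f (Function.update (S.piecewise τ σ) y (τ y)) - f σ
        = (f (Function.update (S.piecewise τ σ) y (τ y)) - f (S.piecewise τ σ))
          + (f (S.piecewise τ σ) - f σ) := by ring
    rw [this]
    exact (enorm_add_le _ _).trans (add_le_add (enorm_sub_le_osc _ _ _ _) ih)

lemma tendsto_piecewise (σ τ : Config Γ) :
    Tendsto (fun S : Finset Γ => S.piecewise τ σ) atTop (𝓝 τ) := by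
  refine tendsto_pi_nhds.2 fun y => tendsto_const_nhds.congr' ?_
  filter_upwards [eventually_ge_atTop {y}] with S hS
  rw [Finset.piecewise_eq_of_mem _ _ _ (hS (Finset.mem_singleton_self y))]

/-- Spins are changed one at a time over a finite set, which then exhausts `Γ`; continuity in the
product topology takes care of the limit. -/
lemma enorm_sub_le_tsum_osc (f : C(Config Γ, ℂ)) (σ τ : Config Γ) :
    ‖f τ - f σ‖ₑ ≤ ∑' y, osc y f := by
  have h : Tendsto (fun S : Finset Γ => ‖f (S.piecewise τ σ) - f σ‖ₑ) atTop
      (𝓝 ‖f τ - f σ‖ₑ) :=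
    (((f.continuous.tendsto τ).comp (tendsto_piecewise σ τ)).sub_const (f σ)).enorm
  exact le_of_tendsto' h fun S => (enorm_piecewise_sub_le f σ τ S).trans (ENNReal.sum_le_tsum S)

/-! ### The interaction of two sites -/

namespace Potential

/-- The total strength of the interactions between the sites `x` and `y`. -/
def pairing (φ : Potential Γ) (x y : Γ) : ℝ≥0∞ :=
  ∑' X : Finset Γ, if x ∈ X ∧ y ∈ X then ‖φ.multi X‖ₑ else 0

lemma tsum_multi_eq (φ : Potential Γ) (x : Γ) :
    ∑' X : {X : Finset Γ // x ∈ X}, (3 ^ (X.1.card - 1) : ℝ≥0∞) * ‖φ.multi X‖ₑ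
      = ∑' X : Finset Γ, if x ∈ X then (3 ^ (X.card - 1) : ℝ≥0∞) * ‖φ.multi X‖ₑ else 0 := by
  refine (tsum_subtype {X : Finset Γ | x ∈ X}
    fun X => (3 ^ (X.card - 1) : ℝ≥0∞) * ‖φ.multi X‖ₑ).trans (tsum_congr fun X => ?_)
  simp [Set.indicator_apply]

lemma pairing_le (φ : Potential Γ) (x y : Γ) : φ.pairing x y ≤ φ.multiNorm (Real.log 3) := by
  refine le_trans ?_ (φ.tsum_multi_le x)
  rw [tsum_multi_eq]
  refine ENNReal.tsum_le_tsum fun X => ?_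
  by_cases hx : x ∈ X <;> by_cases hy : y ∈ X <;> simp only [hx, hy, and_self, and_false,
    and_true, if_true, if_false, zero_le, le_refl]
  exact le_mul_of_one_le_left' (one_le_pow₀ (by norm_num))

lemma three_mul_le_three_pow (m : ℕ) : 3 * m ≤ 3 ^ m := by
  rcases m with _ | m
  · simp
  · rw [pow_succ, mul_comm]
    exact Nat.mul_le_mul_right 3 (Nat.lt_pow_self (by norm_num))

/-- Exchanging the sums counts each `X ∋ x` once for every other site, that is `|X| - 1` times, and
`3n ≤ 3^n`. This is where the weight `e^{(log 3)(|X|-1)}` yields its quantitative gain. -/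
lemma three_mul_tsum_pairing_le (φ : Potential Γ) (x : Γ) :
    3 * ∑' y, (if y = x then 0 else φ.pairing x y) ≤ φ.multiNorm (Real.log 3) := by
  refine le_trans ?_ (φ.tsum_multi_le x)
  have h1 : ∀ y, (if y = x then 0 else φ.pairing x y)
      = ∑' X : Finset Γ, if x ∈ X ∧ y ∈ X.erase x then ‖φ.multi X‖ₑ else 0 := by
    intro y
    by_cases hy : y = x
    · simp [hy]
    · simp [hy, pairing]
  simp only [h1]
  rw [ENNReal.tsum_comm, ← ENNReal.tsum_mul_left, tsum_multi_eq]
  refine ENNReal.tsum_le_tsum fun X => ?_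
  by_cases hx : x ∈ X
  · simp only [hx, true_and, if_true]
    rw [tsum_eq_sum (s := X.erase x) (fun y hy => if_neg hy), Finset.sum_ite_mem,
      Finset.inter_self, Finset.sum_const, nsmul_eq_mul, ← mul_assoc, Finset.card_erase_of_mem hx]
    gcongr
    exact_mod_cast three_mul_le_three_pow (X.card - 1)
  · simp [hx]

lemma enorm_sitePart_sub_le (φ : Potential Γ) {x y : Γ} (hxy : y ≠ x) (σ : Config Γ) (t : S2)
    (X : Finset Γ) : ‖φ.sitePart x X (Function.update σ y t) - φ.sitePart x X σ‖ₑ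
      ≤ 2 * if x ∈ X ∧ y ∈ X then ‖φ.multi X‖ₑ else 0 := by
  by_cases hy : y ∈ X
  · by_cases hx : x ∈ X
    · have hcard : 2 ≤ X.card := Finset.one_lt_card.2 ⟨y, hy, x, hx, hxy⟩
      rw [sitePart, if_pos hx, if_pos ⟨hx, hy⟩, multi, if_pos hcard, ← ofReal_norm, ← ofReal_norm,
        two_mul, ← ENNReal.ofReal_add (norm_nonneg _) (norm_nonneg _)]
      refine ENNReal.ofReal_le_ofReal ((norm_sub_le _ _).trans ?_)
      linarith [(φ.toFun X).norm_coe_le_norm (Function.update σ y t),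
        (φ.toFun X).norm_coe_le_norm σ]
    · simp [sitePart, hx]
  · rw [apply_update_of_notMem (φ.sitePart_mem x X) hy]
    simp

lemma norm_siteEnergy_sub_le (φ : Potential Γ) (hφ : φ.multiNorm (Real.log 3) < ⊤) {x y : Γ}
    (hxy : y ≠ x) (σ : Config Γ) (t : S2) :
    ‖φ.siteEnergy x (Function.update σ y t) - φ.siteEnergy x σ‖
      ≤ 2 * (φ.pairing x y).toReal := by
  have hs := φ.summable_sitePart hφ x
  have heval : ∀ τ : Config Γ, HasSum (fun X => φ.sitePart x X τ) (φ.siteEnergy x τ) := fun τ =>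
    (ContinuousMap.evalCLM ℂ τ : C(Config Γ, ℂ) →L[ℂ] ℂ).hasSum hs.hasSum
  have h := ((heval (Function.update σ y t)).sub (heval σ)).tsum_eq
  have h2 : ‖φ.siteEnergy x (Function.update σ y t) - φ.siteEnergy x σ‖ₑ
      ≤ 2 * φ.pairing x y := by
    rw [← h, pairing, ← ENNReal.tsum_mul_left]
    exact enorm_tsum_le_tsum_enorm.trans
      (ENNReal.tsum_le_tsum fun X => φ.enorm_sitePart_sub_le hxy σ t X)
  have hp : φ.pairing x y ≠ ⊤ := ((φ.pairing_le x y).trans_lt hφ).ne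
  have h3 := ENNReal.toReal_mono (ENNReal.mul_ne_top (by norm_num) hp) h2
  rwa [toReal_enorm, ENNReal.toReal_mul, ENNReal.toReal_ofNat] at h3

/-- A bound on the influence of the spin at `y` on the conditional distribution at `x`. -/
def influence (φ : Potential Γ) (β : ℝ) (x y : Γ) : ℝ≥0∞ :=
  if y = x then 0 else ENNReal.ofReal (8 * β) * φ.pairing x y

lemma tsum_influence_le (φ : Potential Γ) {β : ℝ}
    (h : ENNReal.ofReal β < ENNReal.ofReal (Real.log 2) / (6 * φ.multiNorm (Real.log 3))) (x : Γ) :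
    ∑' y, φ.influence β x y ≤ 2⁻¹ := by
  have h1 : ∑' y, φ.influence β x y
      = ENNReal.ofReal (8 * β) * ∑' y, (if y = x then 0 else φ.pairing x y) := by
    rw [← ENNReal.tsum_mul_left]
    refine tsum_congr fun y => ?_
    unfold influence
    split_ifs <;> simp
  -- Only `log 2 ≤ 1` is used. With the factor 3 above this gives `18βT ≤ 1`, so the total influence
  -- `8βT` is at most 4/9.
  have h2 : ENNReal.ofReal β * (6 * φ.multiNorm (Real.log 3)) ≤ 1 := by
    refine (ENNReal.mul_le_of_le_div h.le).trans ?_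
    rw [ENNReal.ofReal_le_one]
    linarith [Real.log_two_lt_d9]
  have h3 := φ.three_mul_tsum_pairing_le x
  rw [h1, ENNReal.ofReal_mul (by norm_num)]
  set T := ∑' y, (if y = x then 0 else φ.pairing x y)
  have h4 : 18 * (ENNReal.ofReal β * T) ≤ 1 := by
    calc 18 * (ENNReal.ofReal β * T) = ENNReal.ofReal β * (6 * (3 * T)) := by ring
      _ ≤ _ := by gcongr
      _ ≤ 1 := h2
  rw [← one_div, ENNReal.le_div_iff_mul_le (by simp) (by simp)]
  calc ENNReal.ofReal 8 * ENNReal.ofReal β * T * 2 = 16 * (ENNReal.ofReal β * T) := by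
        rw [ENNReal.ofReal_ofNat]; ring
    _ ≤ 18 * (ENNReal.ofReal β * T) := by gcongr; norm_num
    _ ≤ 1 := h4

end Potential

lemma osc_siteGibbs_le {φ : Potential Γ} (hφ : φ.multiNorm (Real.log 3) < ⊤) {β : ℝ} (hβ : 0 ≤ β)
    {x : Γ} (hsum : ∑' y, φ.influence β x y ≤ 2⁻¹) (f : C(Config Γ, ℂ)) (y : Γ) :
    osc y (siteGibbs φ β x f)
      ≤ (if y = x then 0 else osc y f) + φ.influence β x y * osc x f := by
  refine iSup₂_le fun σ s => ?_
  by_cases hxy : y = x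
  · subst hxy
    rw [siteGibbs_update]
    simp
  have hp : φ.pairing x y ≠ ⊤ := ((φ.pairing_le x y).trans_lt hφ).ne
  have hinf : φ.influence β x y = ENNReal.ofReal (8 * β * (φ.pairing x y).toReal) := by
    rw [Potential.influence, if_neg hxy,
      ENNReal.ofReal_mul (p := 8 * β) (by positivity), ENNReal.ofReal_toReal hp]
  have hsmall : 8 * β * (φ.pairing x y).toReal ≤ 1 := by
    have h1 := (ENNReal.le_tsum (f := fun y => φ.influence β x y) y).trans hsum
    rw [hinf] at h1
    exact ENNReal.ofReal_le_one.1 (h1.trans (by simp))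
  have hcomm : ∀ t, Function.update (Function.update σ y s) x t
      = Function.update (Function.update σ x t) y s := fun t => Function.update_comm hxy _ _ _
  have hcont : ∀ τ : Config Γ, Continuous fun t => f (Function.update τ x t) := fun τ =>
    f.continuous.comp (continuous_const.update x continuous_id)
  -- Changing the spin at `y` moves `βH_x` by at most `D = 2β · pairing`, so the coefficient `4D` is
  -- exactly the influence `8β · pairing`.
  have key := norm_sphereGibbs_sub_le
    (continuous_const.mul (continuous_siteEnergy_update φ x (Function.update σ y s)))
    (continuous_const.mul (continuous_siteEnergy_update φ x σ))
    (hcont (Function.update σ y s)) (hcont σ) (D := 2 * β * (φ.pairing x y).toReal)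
    (ε := (osc y f).toReal) (η := (osc x f).toReal) (h := fun t => β * _) (h' := fun t => β * _)
    (fun t => by
      rw [hcomm, ← mul_sub, abs_mul, abs_of_nonneg hβ, ← Complex.sub_re]
      have h1 := φ.norm_siteEnergy_sub_le hφ hxy (Function.update σ x t) s
      have h2 := (Complex.abs_re_le_norm _).trans h1
      nlinarith)
    (by linarith)
    (fun t => by rw [hcomm]; exact norm_sub_le_osc y f _ s) (σ x)
    (fun t => by rw [Function.update_eq_self]; exact norm_sub_le_osc x f σ t)
  rw [← siteGibbs_apply, ← siteGibbs_apply] at key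
  rw [if_neg hxy, hinf, ← ofReal_norm]
  refine (ENNReal.ofReal_le_ofReal key).trans (le_of_eq ?_)
  rw [ENNReal.ofReal_add ENNReal.toReal_nonneg (by positivity),
    ENNReal.ofReal_toReal (osc_ne_top _ _), ENNReal.ofReal_mul (by positivity),
    ENNReal.ofReal_toReal (osc_ne_top _ _)]
  congr 3
  ring

/-! ### Dobrushin's uniqueness argument -/

/-- `r` bounds the sensitivity of `ω₁ - ω₂` to the oscillations of the observables. -/
def IsEstimate (ω₁ ω₂ : C(Config Γ, ℂ) →ₚ[ℂ] ℂ) (r : Γ → ℝ≥0∞) : Prop :=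
  ∀ f, ‖ω₁ f - ω₂ f‖ₑ ≤ ∑' y, r y * osc y f

lemma IsEstimate.mono {ω₁ ω₂ : C(Config Γ, ℂ) →ₚ[ℂ] ℂ} {r r' : Γ → ℝ≥0∞}
    (h : IsEstimate ω₁ ω₂ r) (hr : ∀ y, r y ≤ r' y) : IsEstimate ω₁ ω₂ r' := fun f =>
  (h f).trans (ENNReal.tsum_le_tsum fun y => by gcongr; exact hr y)

/-- States agree on constants, so a value of `f` can be subtracted; the remainder is bounded by the
total oscillation, and 8 is twice the constant of `norm_state_le`. -/
lemma isEstimate_const {ω₁ ω₂ : C(Config Γ, ℂ) →ₚ[ℂ] ℂ} (h₁ : IsState ω₁) (h₂ : IsState ω₂) :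
    IsEstimate ω₁ ω₂ fun _ => 8 := by
  intro f
  rw [ENNReal.tsum_mul_left]
  set σ : Config Γ := fun _ => axis 0
  set g := f - f σ • (1 : C(Config Γ, ℂ)) with hg
  have hω : ω₁ f - ω₂ f = ω₁ g - ω₂ g := by
    rw [hg, map_sub, map_sub, map_smul, map_smul, show ω₁ 1 = 1 from h₁, show ω₂ 1 = 1 from h₂]
    ring
  have h1 : ‖g‖ₑ ≤ ∑' y, osc y f := enorm_le_of_forall_apply fun τ => by
    simpa [hg] using enorm_sub_le_tsum_osc f σ τ
  rw [hω]
  refine le_trans ?_ (mul_le_mul_right h1 8)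
  rw [← ofReal_norm, ← ofReal_norm, ← ENNReal.ofReal_ofNat 8, ← ENNReal.ofReal_mul (by norm_num)]
  refine ENNReal.ofReal_le_ofReal ((norm_sub_le _ _).trans ?_)
  linarith [norm_state_le h₁ g, norm_state_le h₂ g]

/-- Both states are invariant under the conditional expectation at `x`, so the estimate may be
applied to `siteGibbs φ β x f`. There the oscillation at `x` is gone, and what it contributes to the
other sites becomes the new coefficient at `x`. -/
lemma IsEstimate.update {φ : Potential Γ} (hφ : φ.multiNorm (Real.log 3) < ⊤) {β : ℝ}
    (hβ : 0 ≤ β) {ω₁ ω₂ : C(Config Γ, ℂ) →ₚ[ℂ] ℂ} {r : Γ → ℝ≥0∞} (h : IsEstimate ω₁ ω₂ r) (x : Γ)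
    (h₁ : ∀ f, ω₁ (siteGibbs φ β x f) = ω₁ f) (h₂ : ∀ f, ω₂ (siteGibbs φ β x f) = ω₂ f)
    (hsum : ∑' y, φ.influence β x y ≤ 2⁻¹) :
    IsEstimate ω₁ ω₂ (Function.update r x (∑' y, r y * φ.influence β x y)) := by
  intro f
  rw [← h₁ f, ← h₂ f]
  refine (h _).trans ?_
  calc ∑' y, r y * osc y (siteGibbs φ β x f)
      ≤ ∑' y, (r y * (if y = x then 0 else osc y f) + r y * φ.influence β x y * osc x f) := by
        refine ENNReal.tsum_le_tsum fun y => ?_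
        rw [mul_assoc, ← mul_add]
        gcongr
        exact osc_siteGibbs_le hφ hβ hsum f y
    _ = (∑' y, r y * φ.influence β x y) * osc x f
          + ∑' y, r y * (if y = x then 0 else osc y f) := by
        rw [ENNReal.tsum_add, ENNReal.tsum_mul_right, add_comm]
    _ = _ := by
        rw [ENNReal.tsum_eq_add_tsum_ite (f := fun y => Function.update r x
          (∑' y, r y * φ.influence β x y) y * osc y f) x, Function.update_self]
        congr 1
        refine tsum_congr fun y => ?_
        by_cases hy : y = x
        · simp [hy]
        · simp [hy]

/-- Updating the sites of a finite `V` one after another halves the coefficients on `V`, since at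
each stage all coefficients are still at most `R`. As `V` exhausts `Γ`, the part outside `V` is the
tail of a convergent sum. -/
lemma IsEstimate.half {φ : Potential Γ} (hφ : φ.multiNorm (Real.log 3) < ⊤) {β : ℝ}
    (hβ : 0 ≤ β) {ω₁ ω₂ : C(Config Γ, ℂ) →ₚ[ℂ] ℂ} {R : ℝ≥0∞} (hR : R ≠ ⊤) (hR0 : R ≠ 0)
    (h : IsEstimate ω₁ ω₂ fun _ => R)
    (h₁ : ∀ x f, ω₁ (siteGibbs φ β x f) = ω₁ f) (h₂ : ∀ x f, ω₂ (siteGibbs φ β x f) = ω₂ f)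
    (hsum : ∀ x, ∑' y, φ.influence β x y ≤ 2⁻¹) :
    IsEstimate ω₁ ω₂ fun _ => R * 2⁻¹ := by
  have hhalf : R * 2⁻¹ ≤ R := mul_le_of_le_one_right' (by simp)
  have hV : ∀ V : Finset Γ, IsEstimate ω₁ ω₂ fun y => if y ∈ V then R * 2⁻¹ else R := by
    intro V
    induction V using Finset.induction_on with
    | empty => simpa using h
    | insert x V hx ih =>
      refine (ih.update hφ hβ x (h₁ x) (h₂ x) (hsum x)).mono fun y => ?_
      by_cases hy : y = x
      · subst hy
        rw [Function.update_self, if_pos (Finset.mem_insert_self _ _)]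
        calc _ ≤ ∑' z, R * φ.influence β y z := by
              refine ENNReal.tsum_le_tsum fun z => ?_
              gcongr
              split_ifs
              exacts [hhalf, le_rfl]
          _ ≤ R * 2⁻¹ := by
              rw [ENNReal.tsum_mul_left]
              gcongr
              exact hsum y
      · simp [hy]
  intro f
  rw [ENNReal.tsum_mul_left]
  -- Here `R ≠ 0` matters: it makes the bound infinite, hence trivial, when the total oscillation is
  -- infinite.
  by_cases hT : ∑' y, osc y f = ⊤
  · rw [hT, ENNReal.mul_top (by simp [hR0])]
    exact le_top
  have hlim : Tendsto (fun V : Finset Γ => R * 2⁻¹ * ∑' y, osc y f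
      + R * ∑' y : {y // y ∉ V}, osc (y : Γ) f) atTop (𝓝 (R * 2⁻¹ * ∑' y, osc y f + R * 0)) :=
    tendsto_const_nhds.add
      (ENNReal.Tendsto.const_mul (ENNReal.tendsto_tsum_compl_atTop_zero hT) (Or.inr hR))
  rw [mul_zero, add_zero] at hlim
  refine ge_of_tendsto' hlim fun V => (hV V f).trans ?_
  have hc : ∑' y : {y // y ∉ V}, osc (y : Γ) f = ∑' y, if y ∉ V then osc y f else 0 :=
    (tsum_subtype {y | y ∉ V} fun y => osc y f).trans
      (tsum_congr fun y => by simp [Set.indicator_apply])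
  rw [hc, ← ENNReal.tsum_mul_left, ← ENNReal.tsum_mul_left, ← ENNReal.tsum_add]
  refine ENNReal.tsum_le_tsum fun y => ?_
  by_cases hy : y ∈ V <;> simp [hy]

/-- The iterated bounds `8 · 2⁻ⁿ` are useful only for finite total oscillation. Local observables
have it, and they are dense. -/
theorem kms_unique {φ : Potential Γ} (hφ : φ.multiNorm (Real.log 3) < ⊤)
    (hs : ∀ a : smoothObs Γ, Summable (φ.term a)) {β : ℝ} (hβ : 0 ≤ β)
    (hβ' : ENNReal.ofReal β < ENNReal.ofReal (Real.log 2) / (6 * φ.multiNorm (Real.log 3)))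
    {ω₁ ω₂ : C(Config Γ, ℂ) →ₚ[ℂ] ℂ} (h₁ : IsKMS β φ.deriv ω₁) (h₂ : IsKMS β φ.deriv ω₂) :
    ω₁ = ω₂ := by
  have hest : ∀ n : ℕ, IsEstimate ω₁ ω₂ fun _ => 8 * (2⁻¹ : ℝ≥0∞) ^ n := by
    intro n
    induction n with
    | zero => simpa using isEstimate_const h₁.1 h₂.1
    | succ n ih =>
      simp only [pow_succ, ← mul_assoc]
      exact ih.half hφ hβ (ENNReal.mul_ne_top (by simp) (by simp)) (by simp)
        (kms_siteGibbs hφ hs h₁) (kms_siteGibbs hφ hs h₂) (φ.tsum_influence_le hβ')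
  have hsmooth : Set.EqOn ω₁ ω₂ (smoothObs Γ) := by
    intro f hf
    obtain ⟨Λ, hΛ⟩ := Set.mem_iUnion.1 hf
    have hT : ∑' y, osc y f ≠ ⊤ := by
      rw [tsum_eq_sum (s := Λ) fun y hy => osc_eq_zero hΛ hy]
      exact ENNReal.sum_ne_top.2 fun y _ => osc_ne_top y f
    have hlim : Tendsto (fun n : ℕ => 8 * (2⁻¹ : ℝ≥0∞) ^ n * ∑' y, osc y f) atTop (𝓝 0) := by
      have h := ENNReal.Tendsto.mul_const (b := ∑' y, osc y f)
        (ENNReal.Tendsto.const_mul (a := 8)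
        (ENNReal.tendsto_pow_atTop_nhds_zero_of_lt_one (r := 2⁻¹) (by simp)) (Or.inr (by simp)))
        (Or.inr hT)
      simpa using h
    have h0 : ‖ω₁ f - ω₂ f‖ₑ ≤ 0 := ge_of_tendsto' hlim fun n => by
      rw [← ENNReal.tsum_mul_left]
      exact hest n f
    exact sub_eq_zero.1 (enorm_eq_zero.1 (le_antisymm h0 zero_le))
  exact PositiveLinearMap.ext fun f =>
    congrFun (Continuous.ext_on dense_smoothObs (map_continuous ω₁) (map_continuous ω₂) hsmooth) f

end SpinLattice

end

theorem mainTheorem2 {Γ : Type*} [Countable Γ] (φ : SpinLattice.Potential Γ)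
    (hC1 : φ.multiC1 < ⊤) (hnorm : φ.multiNorm (Real.log 3) < ⊤) :
    (∀ a : SpinLattice.smoothObs Γ, Summable (φ.term a)) ∧
    ∀ β : ℝ, 0 ≤ β →
      ENNReal.ofReal β < ENNReal.ofReal (Real.log 2) / (6 * φ.multiNorm (Real.log 3)) →
      ∃! ω : C(SpinLattice.Config Γ, ℂ) →ₚ[ℂ] ℂ, SpinLattice.IsKMS β φ.deriv ω := by
  have hs := SpinLattice.summable_term φ hC1
  refine ⟨hs, fun β hβ hβ' => ?_⟩
  obtain ⟨ω, hω⟩ := SpinLattice.exists_isKMS φ hs β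
  exact ⟨ω, hω, fun ω' hω' => SpinLattice.kms_unique hnorm hs hβ hβ' hω' hω⟩
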